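/- Conventions. On $\mathbb R^3$ let $\langle a,b\rangle_E=a_1b_1+a_2b_2+a_3b_3$, $\langle a,b\rangle_L=a_1b_1+a_2b_2-a_3b_3$, $a\times_E b=(a_2b_3-b_2a_3,\;a_3b_1-b_3a_1,\;a_1b_2-b_1a_2)$ and $a\times_L b=(a_2b_3-b_2a_3,\;a_3b_1-b_3a_1,\;-(a_1b_2-b_1a_2))$; write $\mathbb E^3=(\mathbb R^3,\langle\,,\rangle_E)$, $\mathbb L^3=(\mathbb R^3,\langle\,,\rangle_L)$. Manifolds, maps and metrics are smooth. For an oriented Riemannian (resp. Lorentzian) $2$-manifold, the Hodge operator on $1$-forms is given in a positively oriented orthonormal coframe by $*\omega^1=\omega^2,\ *\omega^2=-\omega^1$ (resp. $*\omega^1=\omega^2,\ *\omega^2=\omega^1$, where $\omega^1$ is spacelike and $\omega^2$ timelike). Consider immersions $x:M\to N$ of an oriented surface of one of the three kinds: (i) $N=\mathbb E^3$; (ii) $N=\mathbb L^3$, $x$ spacelike; (iii) $N=\mathbb L^3$, $x$ timelike; put $\times=\times_E$ in (i) and $\times=\times_L$ in (ii), (iii). For a positively oriented orthonormal tangent frame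 $e_1,e_2$ (in (iii): $e_1$ spacelike, $e_2$ timelike), the Gauss map is $n=e_1\times e_2$ in (i) and $n=-e_1\times e_2$ in (ii), (iii); the mean curvature is $\tfrac12\operatorname{tr}_{\mathrm I}\mathrm{II}$ with $\mathrm I=\langle dx,dx\rangle$ and $\mathrm{II}=-\langle dx,dn\rangle$. The symbol $\int\theta$ denotes any map $y:M\to\mathbb R^3$ with $dy=\theta$. Let $H\neq0$ be a real constant. (a) Let $M$ be a connected, oriented $2$-manifold and let $x:M\to N$ be an immersion of kind (i), (ii) or (iii) with constant mean curvature $H$ and Gauss map $n$. Then, with $*$ the Hodge operator of the induced metric, the $1$-form $n\times(*dn)$ has a primitive, and for a suitable choice of it $$x=-\frac1{2H}\Big\{n+\int n\times(*dn)\Big\}.\qquad(1)$$ (b) Conversely, let $M$ be a simply connected, oriented $2$-manifold with a metric $g$, and let $n:M\to\mathbb R^3$ be smooth, where either (i) $g$ is Riemannian and $\langle n,n\rangle_E=1$; (ii) $g$ is Riemannian and $\langle n,n\rangle_L=-1$; or (iii) $g$ is Lorentzian and $\langle n,n\rangle_L=1$. With $*$ the Hodge operator of $g$, suppose that $d{*}dn$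 is everywhere parallel to $n$ (i.e. its values are multiples of $n$) and that $\eta=dn+n\times(*dn)$ satisfies: $\eta_p\ne0$ for every $p\in M$ in cases (i), (ii); $\eta_p(v)\neq0$ for every $p\in M$ and every nonzero $v\in T_pM$ in case (iii). Then $n\times(*dn)$ has a primitive, and for every choice of the primitive, (1) defines (i) an immersion into $\mathbb E^3$, (ii) a spacelike immersion into $\mathbb L^3$, or (iii) a timelike immersion into $\mathbb L^3$, respectively, with constant mean curvature $H$ and Gauss map $n$; here the Gauss map refers to the given orientation of $M$ in cases (i), (ii), and to the given or the opposite orientation of $M$ in case (iii). -/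

import Mathlib

open scoped Manifold ContDiff Topology

noncomputable section

namespace Kenmotsu

/-- The space `ℝ³` underlying Euclidean 3-space `𝔼³` and Lorentzian 3-space `𝕃³`. -/
abbrev R3 : Type := Fin 3 → ℝ

/-- The model plane. -/
abbrev R2 : Type := EuclideanSpace ℝ (Fin 2)

/-- The three kinds of surfaces: surfaces in `𝔼³`, spacelike surfaces in `𝕃³`,
timelike surfaces in `𝕃³`. -/
inductive Kind
  | euclidean
  | spacelike
  | timelike

/-- The sign of the third coordinate in the scalar product of the ambient space. -/
def Kind.ambientSign : Kind → ℝ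
  | .euclidean => 1
  | .spacelike => -1
  | .timelike => -1

/-- The value `⟨n, n⟩` of a unit normal `n`. -/
def Kind.normalSign : Kind → ℝ
  | .euclidean => 1
  | .spacelike => -1
  | .timelike => 1

/-- The value `⟨e₂, e₂⟩` for an orthonormal tangent frame `e₁, e₂` with `⟨e₁, e₁⟩ = 1`. -/
def Kind.frameSign : Kind → ℝ
  | .euclidean => 1
  | .spacelike => 1
  | .timelike => -1

/-- The sign in `n = ± e₁ × e₂`, for `e₁, e₂` a positively oriented orthonormal tangent frame. -/
def Kind.gaussSign : Kind → ℝ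
  | .euclidean => 1
  | .spacelike => -1
  | .timelike => -1

/-- The scalar product `⟨a, b⟩ = a₁b₁ + a₂b₂ ± a₃b₃` of the ambient space. -/
def Kind.form (K : Kind) : R3 →L[ℝ] R3 →L[ℝ] ℝ :=
  (ContinuousLinearMap.proj (R := ℝ) (φ := fun _ : Fin 3 => ℝ) 0).smulRight
      (ContinuousLinearMap.proj (R := ℝ) (φ := fun _ : Fin 3 => ℝ) 0)
    + (ContinuousLinearMap.proj (R := ℝ) (φ := fun _ : Fin 3 => ℝ) 1).smulRight
      (ContinuousLinearMap.proj (R := ℝ) (φ := fun _ : Fin 3 => ℝ) 1)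
    + K.ambientSign • (ContinuousLinearMap.proj (R := ℝ) (φ := fun _ : Fin 3 => ℝ) 2).smulRight
      (ContinuousLinearMap.proj (R := ℝ) (φ := fun _ : Fin 3 => ℝ) 2)

theorem Kind.form_apply (K : Kind) (a b : R3) :
    K.form a b = a 0 * b 0 + a 1 * b 1 + K.ambientSign * (a 2 * b 2) := by
  simp [Kind.form]

/-- The vector product `b ↦ a × b` of the ambient space (Euclidean or Lorentzian). -/
def Kind.cross (K : Kind) (a : R3) : R3 →L[ℝ] R3 :=
  LinearMap.toContinuousLinearMap
    { toFun := fun b => ![a 1 * b 2 - b 1 * a 2, a 2 * b 0 - b 2 * a 0,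
        K.ambientSign * (a 0 * b 1 - b 0 * a 1)]
      map_add' := by
        intro b c
        ext i
        fin_cases i <;> simp <;> ring
      map_smul' := by
        intro r b
        ext i
        fin_cases i <;> simp <;> ring }

/-! ### Bilinear forms on an oriented plane -/

section Plane

variable {T : Type*} [AddCommGroup T] [Module ℝ T] [TopologicalSpace T]
  [IsTopologicalAddGroup T] [ContinuousSMul ℝ T] [T2Space T]

/-- The bilinear form `g` is positive definite (first two kinds), or takes positive and negative
values (third kind; in dimension two, a symmetric form with this property has signature `(1,1)`). -/
def Kind.HasSignature (K : Kind) (g : T →L[ℝ] T →L[ℝ] ℝ) : Prop :=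
  match K with
  | .euclidean => ∀ v, v ≠ 0 → 0 < g v v
  | .spacelike => ∀ v, v ≠ 0 → 0 < g v v
  | .timelike => (∃ v, 0 < g v v) ∧ ∃ v, g v v < 0

variable [FiniteDimensional ℝ T] [Fact (Module.finrank ℝ T = 2)]

/-- A positively oriented basis. -/
def posBasis (o : Orientation ℝ T (Fin 2)) : Module.Basis (Fin 2) ℝ T :=
  o.someBasis (by rw [Fintype.card_fin]; exact (Fact.out : Module.finrank ℝ T = 2).symm)

/-- The volume form of the form `g` on the oriented plane `T`: it is
`√|det (g (b i) (b j))| · b⁰ ∧ b¹` for any positively oriented basis `b`. -/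
def volForm (g : T →L[ℝ] T →L[ℝ] ℝ) (o : Orientation ℝ T (Fin 2)) : T →L[ℝ] T →L[ℝ] ℝ :=
  let b := posBasis o
  let c : Fin 2 → (T →L[ℝ] ℝ) := fun i => LinearMap.toContinuousLinearMap (b.coord i)
  √|g (b 0) (b 0) * g (b 1) (b 1) - g (b 0) (b 1) * g (b 1) (b 0)| •
    ((c 0).smulRight (c 1) - (c 1).smulRight (c 0))

/-- The endomorphism `J` with `g (J v) w = vol v w`. -/
def rot (g : T →L[ℝ] T →L[ℝ] ℝ) (o : Orientation ℝ T (Fin 2)) : T →L[ℝ] T :=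
  g.inverse ∘L volForm g o

/-- The Hodge star of a vector-valued covector `α`. For a scalar covector `α = g a` it is
`*α = vol a`, i.e. `(*α) v = vol a v = - α (J v)`; in terms of a positively oriented
orthonormal coframe, `*ω¹ = ω²` and `*ω² = - ω¹` if `g` is positive definite,
`*ω¹ = ω²` and `*ω² = ω¹` if `g` has signature `(1,1)`, with `ω¹` spacelike. -/
def hodge {F : Type*} [AddCommGroup F] [Module ℝ F] [TopologicalSpace F]
    [IsTopologicalAddGroup F]
    (g : T →L[ℝ] T →L[ℝ] ℝ) (o : Orientation ℝ T (Fin 2)) (α : T →L[ℝ] F) : T →L[ℝ] F :=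
  -(α ∘L rot g o)

end Plane

/-! ### Surfaces -/

section Surface

variable {M : Type*} [TopologicalSpace M] [ChartedSpace R2 M]

instance (p : M) : T2Space (TangentSpace (𝓡 2) p) := inferInstanceAs (T2Space R2)

instance (p : M) : FiniteDimensional ℝ (TangentSpace (𝓡 2) p) :=
  inferInstanceAs (FiniteDimensional ℝ R2)

instance (p : M) : Fact (Module.finrank ℝ (TangentSpace (𝓡 2) p) = 2) :=
  ⟨show Module.finrank ℝ R2 = 2 by simp⟩

/-- A family of orientations of the tangent planes is an orientation of the surface `M`
if it is locally constant in the local trivializations of the tangent bundle. -/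
def IsOrientation [IsManifold (𝓡 2) ∞ M]
    (o : ∀ p : M, Orientation ℝ (TangentSpace (𝓡 2) p) (Fin 2)) : Prop :=
  ∀ p : M, ∃ o₀ : Orientation ℝ R2 (Fin 2), ∀ᶠ q in 𝓝 p,
    ∀ hq : q ∈ (trivializationAt R2 (TangentSpace (𝓡 2) : M → Type _) p).baseSet,
      Orientation.map (Fin 2)
        ((trivializationAt R2 (TangentSpace (𝓡 2) : M → Type _) p).continuousLinearEquivAt
          ℝ q hq).toLinearEquiv (o q) = o₀

/-- A smooth metric on `M`, Riemannian for the first two kinds and Lorentzian for the third. -/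
structure IsMetric [IsManifold (𝓡 2) ∞ M] (K : Kind)
    (g : ∀ p : M, TangentSpace (𝓡 2) p →L[ℝ] TangentSpace (𝓡 2) p →L[ℝ] ℝ) : Prop where
  symm : ∀ p v w, g p v w = g p w v
  signature : ∀ p, K.HasSignature (g p)
  contMDiff : ContMDiff (𝓡 2) ((𝓡 2).prod 𝓘(ℝ, R2 →L[ℝ] R2 →L[ℝ] ℝ)) ∞
    (fun p => Bundle.TotalSpace.mk' (R2 →L[ℝ] R2 →L[ℝ] ℝ)
      (E := fun q : M => TangentSpace (𝓡 2) q →L[ℝ] TangentSpace (𝓡 2) q →L[ℝ] ℝ) p (g p))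

/-- The bilinear form `(v, w) ↦ ⟨α v, β w⟩`. -/
def pairing {p : M} (K : Kind) (α β : TangentSpace (𝓡 2) p →L[ℝ] R3) :
    TangentSpace (𝓡 2) p →L[ℝ] TangentSpace (𝓡 2) p →L[ℝ] ℝ :=
  (ContinuousLinearMap.precomp ℝ β) ∘L K.form ∘L α

/-- The first fundamental form (induced metric) `⟨dx, dx⟩`. -/
def firstForm (K : Kind) (x : M → R3) (p : M) :
    TangentSpace (𝓡 2) p →L[ℝ] TangentSpace (𝓡 2) p →L[ℝ] ℝ :=
  pairing K (mvfderiv (𝓡 2) x p) (mvfderiv (𝓡 2) x p)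

/-- The second fundamental form `-⟨dx, dn⟩`. -/
def secondForm (K : Kind) (x n : M → R3) (p : M) :
    TangentSpace (𝓡 2) p →L[ℝ] TangentSpace (𝓡 2) p →L[ℝ] ℝ :=
  -pairing K (mvfderiv (𝓡 2) x p) (mvfderiv (𝓡 2) n p)

/-- The mean curvature: half the trace of the second fundamental form with respect to the first. -/
def meanCurvature (K : Kind) (x n : M → R3) (p : M) : ℝ :=
  (1 / 2) * LinearMap.trace ℝ (TangentSpace (𝓡 2) p)
    ((firstForm K x p).inverse ∘L secondForm K x n p).toLinearMap

/-- A smooth immersion of the given kind: into `𝔼³`, spacelike into `𝕃³` or timelike into `𝕃³`. -/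
structure IsImmersionOfKind (K : Kind) (x : M → R3) : Prop where
  contMDiff : ContMDiff (𝓡 2) 𝓘(ℝ, R3) ∞ x
  injective : ∀ p, Function.Injective (mvfderiv (𝓡 2) x p)
  signature : ∀ p, K.HasSignature (firstForm K x p)

/-- The Gauss map of an immersion `x` of the given kind, for the orientation `o` of `M`: the smooth
map with `n = ± e₁ × e₂` for positively oriented orthonormal tangent frames `e₁, e₂`. -/
structure IsGaussMap (K : Kind) (o : ∀ p : M, Orientation ℝ (TangentSpace (𝓡 2) p) (Fin 2))
    (x n : M → R3) : Prop where
  contMDiff : ContMDiff (𝓡 2) 𝓘(ℝ, R3) ∞ n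
  eq_cross : ∀ (p : M) (e : Module.Basis (Fin 2) ℝ (TangentSpace (𝓡 2) p)),
    e.orientation = o p →
    firstForm K x p (e 0) (e 0) = 1 →
    firstForm K x p (e 0) (e 1) = 0 →
    firstForm K x p (e 1) (e 1) = K.frameSign →
    n p = K.gaussSign • K.cross (mvfderiv (𝓡 2) x p (e 0)) (mvfderiv (𝓡 2) x p (e 1))

/-- `x` is an immersion of the given kind with Gauss map `n` and constant mean curvature `H`. -/
structure IsCMC (K : Kind) (o : ∀ p : M, Orientation ℝ (TangentSpace (𝓡 2) p) (Fin 2))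
    (H : ℝ) (x n : M → R3) : Prop where
  immersion : IsImmersionOfKind K x
  gaussMap : IsGaussMap K o x n
  meanCurvature_eq : ∀ p, meanCurvature K x n p = H

/-- The `ℝ³`-valued 1-form `*dn`. -/
def starD (g : ∀ p : M, TangentSpace (𝓡 2) p →L[ℝ] TangentSpace (𝓡 2) p →L[ℝ] ℝ)
    (o : ∀ p : M, Orientation ℝ (TangentSpace (𝓡 2) p) (Fin 2)) (n : M → R3) (p : M) :
    TangentSpace (𝓡 2) p →L[ℝ] R3 :=
  hodge (g p) (o p) (mvfderiv (𝓡 2) n p)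

/-- The `ℝ³`-valued 1-form `n × (*dn)`. -/
def crossStarD (K : Kind)
    (g : ∀ p : M, TangentSpace (𝓡 2) p →L[ℝ] TangentSpace (𝓡 2) p →L[ℝ] ℝ)
    (o : ∀ p : M, Orientation ℝ (TangentSpace (𝓡 2) p) (Fin 2)) (n : M → R3) (p : M) :
    TangentSpace (𝓡 2) p →L[ℝ] R3 :=
  K.cross (n p) ∘L starD g o n p

/-- The 1-form `θ` in the chart around `p`. -/
def chartForm (θ : ∀ q : M, TangentSpace (𝓡 2) q →L[ℝ] R3) (p : M) (y : R2) : R2 →L[ℝ] R3 :=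
  θ ((extChartAt (𝓡 2) p).symm y) ∘L
    mfderiv 𝓘(ℝ, R2) (𝓡 2) (extChartAt (𝓡 2) p).symm y

/-- The exterior derivative `dθ` of a 1-form, computed in the chart around `p`:
`dθ (v, w) = (D_v θ) w - (D_w θ) v`. The tangent plane at `p` is identified with the
model plane through that chart. -/
def extDerivOne (θ : ∀ q : M, TangentSpace (𝓡 2) q →L[ℝ] R3) (p : M)
    (v w : TangentSpace (𝓡 2) p) : R3 :=
  fderiv ℝ (chartForm θ p) (extChartAt (𝓡 2) p p) v w
    - fderiv ℝ (chartForm θ p) (extChartAt (𝓡 2) p p) w v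

/-- `y` is an indefinite integral `∫ θ` of the 1-form `θ`. -/
def IsPrimitive (θ : ∀ p : M, TangentSpace (𝓡 2) p →L[ℝ] R3) (y : M → R3) : Prop :=
  MDifferentiable (𝓡 2) 𝓘(ℝ, R3) y ∧ ∀ p, mvfderiv (𝓡 2) y p = θ p

/-- The condition `dn + n × *dn ≠ 0` on the 1-form `η = dn + n × *dn`. For the first two kinds it
says that `η` vanishes at no point; for timelike surfaces, that `η` annihilates
no nonzero tangent vector. -/
def Kind.Nonvanishing (K : Kind) (η : ∀ p : M, TangentSpace (𝓡 2) p →L[ℝ] R3) : Prop :=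
  match K with
  | .euclidean => ∀ p, η p ≠ 0
  | .spacelike => ∀ p, η p ≠ 0
  | .timelike => ∀ (p : M) (v : TangentSpace (𝓡 2) p), v ≠ 0 → η p v ≠ 0

end Surface

end Kenmotsu

end

open scoped Manifold ContDiff Topology

noncomputable section

namespace Kenmotsu

/-! ### The ambient space -/

namespace Kind

variable (K : Kind)

/-! Everything rests on pointwise algebra of the operation B ↦ η = B + n × *B on linear maps B from
an oriented plane to `R3`. Write ε for `frameSign`. For an orthonormal tangent frame e₀, e₁ with
normal n, the operator n × _ sends e₀ to e₁ and e₁ to -ε e₀, and * acts on covectors by the matching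
rule. Hence B ↦ n × *B compares a rotation in the target with a rotation in the source, and η is
twice the part of B that commutes with these rotations.

For a surface, dn = -dx ∘ S with S self-adjoint. The traceless part of S is killed and the trace
part is doubled, so dn + n × *dn = -2H dx (`IsOrthonormalFrame.add_cross_hodge_eq`). The primitive
wanted in (a) is therefore -2H x - n.

Conversely, let ⟨n, n⟩ be constant and B = dn. Then n × η(b 0) = η(b 1) in any orthonormal frame,
which forces ⟨η, η⟩ = c g, makes η(b 0) × η(b 1) a multiple of n, and gives ⟨η, dn⟩ trace c
(`IsOrthonormalFrame.isConformalAt`). If dx = -(1/2H) η, these three facts yield the signature, the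
Gauss map and the mean curvature of x, provided c ≠ 0.

The form n × *dn is closed: in its exterior derivative the term n × d*dn vanishes because d*dn is
parallel to n, and the term in dn and *dn vanishes because B(v) × *B(w) is symmetric in v and w
(`extDerivOne_crossStarD_eq_zero`). The Poincaré lemma in charts and a covering space argument give
a global primitive (`exists_isPrimitive_of_closed`).

In the Riemannian kinds c > 0, since the complement of n is positive definite. In the Lorentzian
kind c may be negative; then x induces a negative multiple of g, spacelike and timelike directions
change places, and the Gauss map is n for the opposite orientation. Connectedness makes the sign of
c global (`conformal_factor_pos_or_neg`), so one orientation serves all of M. -/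

theorem cross_apply (a b : R3) :
    K.cross a b = ![a 1 * b 2 - b 1 * a 2, a 2 * b 0 - b 2 * a 0,
      K.ambientSign * (a 0 * b 1 - b 0 * a 1)] := rfl

theorem ambientSign_mul_self : K.ambientSign * K.ambientSign = 1 := by
  cases K <;> simp [ambientSign]

theorem frameSign_mul_self : K.frameSign * K.frameSign = 1 := by
  cases K <;> simp [frameSign]

theorem frameSign_ne_zero : K.frameSign ≠ 0 := by
  cases K <;> simp [frameSign]

theorem abs_frameSign : |K.frameSign| = 1 := by
  cases K <;> simp [frameSign]

theorem gaussSign_eq : K.gaussSign = K.ambientSign := by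
  cases K <;> simp [gaussSign, ambientSign]

theorem ambientSign_mul_normalSign : K.ambientSign * K.normalSign = K.frameSign := by
  cases K <;> simp [normalSign, ambientSign, frameSign]

theorem normalSign_ne_zero : K.normalSign ≠ 0 := by
  cases K <;> simp [normalSign]

theorem form_comm (a b : R3) : K.form a b = K.form b a := by
  simp only [form_apply]; ring

theorem cross_self (a : R3) : K.cross a a = 0 := by
  ext i
  fin_cases i <;> simp [cross_apply]

theorem cross_anticomm (a b : R3) : K.cross a b = -K.cross b a := by
  ext i
  fin_cases i
  · simp [cross_apply]
  · simp [cross_apply]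
  · simp [cross_apply]; ring

theorem cross_add_left (a b c : R3) : K.cross (a + b) c = K.cross a c + K.cross b c := by
  ext i
  fin_cases i <;> simp [cross_apply] <;> ring

theorem cross_smul_left (r : ℝ) (a c : R3) : K.cross (r • a) c = r • K.cross a c := by
  ext i
  fin_cases i <;> simp [cross_apply] <;> ring

/-- The vector product as a bilinear map. -/
def crossL : R3 →L[ℝ] R3 →L[ℝ] R3 :=
  LinearMap.toContinuousLinearMap
    { toFun := K.cross
      map_add' := fun a b => by ext1 c; exact K.cross_add_left a b c
      map_smul' := fun r a => by ext1 c; exact K.cross_smul_left r a c }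

theorem form_self_cross (a b : R3) : K.form a (K.cross a b) = 0 := by
  simp only [form_apply, cross_apply]
  simp
  linear_combination (a 2 * (a 0 * b 1 - b 0 * a 1)) * K.ambientSign_mul_self

/-- Invariance of the triple product: `K.cross a` is skew-adjoint for `K.form`. -/
theorem form_cross_left (a b c : R3) : K.form (K.cross a b) c = -K.form b (K.cross a c) := by
  simp only [form_apply, cross_apply]
  simp
  linear_combination (c 2 * (a 0 * b 1 - b 0 * a 1) + b 2 * (a 0 * c 1 - c 0 * a 1)) *
    K.ambientSign_mul_self

/-- Lagrange's formula for the double vector product. -/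
theorem cross_cross (a b c : R3) :
    K.cross a (K.cross b c) = K.ambientSign • (K.form a c • b - K.form a b • c) := by
  ext i
  fin_cases i
  · simp [cross_apply, form_apply]
    linear_combination (a 2 * (b 2 * c 0 - c 2 * b 0)) * K.ambientSign_mul_self
  · simp [cross_apply, form_apply]
    linear_combination (a 2 * (b 2 * c 1 - b 1 * c 2)) * K.ambientSign_mul_self
  · simp only [cross_apply, form_apply]
    simp
    left
    ring

/-- Lagrange's formula twice: z × (a × b) = 0 by the first two conditions, and expanding (a × b) ×
(z × (a × b)) leaves a nonzero multiple of z. Identities between vectors can thus be checked by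
pairing with a, b and their product. -/
theorem eq_zero_of_form_eq_zero {a b z : R3} (ha : K.form z a = 0) (hb : K.form z b = 0)
    (hc : K.form z (K.cross a b) = 0) (hne : K.form (K.cross a b) (K.cross a b) ≠ 0) : z = 0 := by
  have h1 : K.cross z (K.cross a b) = 0 := by
    rw [cross_cross, ha, hb]; simp
  have h2 := K.cross_cross (K.cross a b) z (K.cross a b)
  rw [h1, map_zero, K.form_comm _ z, hc] at h2
  have hδ : K.ambientSign ≠ 0 := fun h => by simpa [h] using K.ambientSign_mul_self
  simpa [hδ, hne] using h2.symm

end Kind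

/-! ### Bilinear forms on an oriented plane -/

section Plane

variable {T : Type*} [AddCommGroup T] [Module ℝ T]

theorem basis_repr_eq (b : Module.Basis (Fin 2) ℝ T) (v : T) :
    b.coord 0 v • b 0 + b.coord 1 v • b 1 = v := by
  have := b.sum_repr v
  rwa [Fin.sum_univ_two] at this

theorem det_basis_apply (b : Module.Basis (Fin 2) ℝ T) (f : Fin 2 → T) :
    b.det f = b.coord 0 (f 0) * b.coord 1 (f 1) - b.coord 1 (f 0) * b.coord 0 (f 1) := by
  rw [Module.Basis.det_apply, Matrix.det_fin_two]
  simp [Module.Basis.toMatrix_apply]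
  ring

variable [TopologicalSpace T] [IsTopologicalAddGroup T] [ContinuousSMul ℝ T] [T2Space T]

theorem form_expand (g : T →L[ℝ] T →L[ℝ] ℝ) (b : Module.Basis (Fin 2) ℝ T) (v w : T) :
    g v w = b.coord 0 v * b.coord 0 w * g (b 0) (b 0) + b.coord 0 v * b.coord 1 w * g (b 0) (b 1)
      + b.coord 1 v * b.coord 0 w * g (b 1) (b 0) + b.coord 1 v * b.coord 1 w * g (b 1) (b 1) := by
  conv_lhs => rw [← basis_repr_eq b v, ← basis_repr_eq b w]
  simp only [map_add, map_smul, add_apply, smul_apply,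
    smul_eq_mul]
  ring

theorem eq_of_apply_basis {F : Type*} [AddCommGroup F] [Module ℝ F] [TopologicalSpace F]
    (b : Module.Basis (Fin 2) ℝ T) {α β : T →L[ℝ] F} (h0 : α (b 0) = β (b 0))
    (h1 : α (b 1) = β (b 1)) : α = β := by
  ext v
  rw [← basis_repr_eq b v]
  simp only [map_add, map_smul, h0, h1]

theorem gram_det_change (g : T →L[ℝ] T →L[ℝ] ℝ) (b c : Module.Basis (Fin 2) ℝ T) :
    g (c 0) (c 0) * g (c 1) (c 1) - g (c 0) (c 1) * g (c 1) (c 0) =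
      (b.det c) ^ 2 * (g (b 0) (b 0) * g (b 1) (b 1) - g (b 0) (b 1) * g (b 1) (b 0)) := by
  rw [det_basis_apply, form_expand g b (c 0) (c 0), form_expand g b (c 1) (c 1),
    form_expand g b (c 0) (c 1), form_expand g b (c 1) (c 0)]
  ring

/-- Evaluation of covectors at a vector. -/
def evalAt (v : T) : (T →L[ℝ] ℝ) →L[ℝ] ℝ where
  toFun ψ := ψ v
  map_add' _ _ := rfl
  map_smul' _ _ := rfl
  cont := continuous_eval_const v

@[simp] theorem evalAt_apply (v : T) (ψ : T →L[ℝ] ℝ) : evalAt v ψ = ψ v := rfl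

variable [FiniteDimensional ℝ T] [Fact (Module.finrank ℝ T = 2)]

theorem posBasis_orientation (o : Orientation ℝ T (Fin 2)) : (posBasis o).orientation = o :=
  Orientation.someBasis_orientation _ _

/-- The volume form in terms of an arbitrary positively oriented basis. -/
theorem volForm_apply (g : T →L[ℝ] T →L[ℝ] ℝ) {o : Orientation ℝ T (Fin 2)}
    (b : Module.Basis (Fin 2) ℝ T) (hb : b.orientation = o) (v w : T) :
    volForm g o v w = √|g (b 0) (b 0) * g (b 1) (b 1) - g (b 0) (b 1) * g (b 1) (b 0)| *
      (b.coord 0 v * b.coord 1 w - b.coord 1 v * b.coord 0 w) := by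
  set c := posBasis o with hc
  have hpos : 0 < b.det c := by
    rw [← Module.Basis.orientation_eq_iff_det_pos, hb, hc, posBasis_orientation]
  have hL : volForm g o v w =
      √|g (c 0) (c 0) * g (c 1) (c 1) - g (c 0) (c 1) * g (c 1) (c 0)| *
      (c.coord 0 v * c.coord 1 w - c.coord 1 v * c.coord 0 w) := by
    simp [volForm, ← hc]
  have hcoord : ∀ (i : Fin 2) (u : T), b.coord i u =
      c.coord 0 u * b.coord i (c 0) + c.coord 1 u * b.coord i (c 1) := by
    intro i u
    conv_lhs => rw [← basis_repr_eq c u]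
    simp only [map_add, map_smul, smul_eq_mul]
  rw [hL, gram_det_change g b c, abs_mul, Real.sqrt_mul (abs_nonneg _), abs_of_nonneg (sq_nonneg _),
    Real.sqrt_sq hpos.le, hcoord 0 v, hcoord 0 w, hcoord 1 v, hcoord 1 w, det_basis_apply]
  ring

/-- A symmetric bilinear form with nonzero Gram determinant is invertible. -/
theorem isInvertible_of_gram_ne_zero (g : T →L[ℝ] T →L[ℝ] ℝ) (b : Module.Basis (Fin 2) ℝ T)
    (hsymm : g (b 0) (b 1) = g (b 1) (b 0))
    (hdet : g (b 0) (b 0) * g (b 1) (b 1) - g (b 0) (b 1) * g (b 0) (b 1) ≠ 0) :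
    g.IsInvertible := by
  set E := g (b 0) (b 0) with hE
  set F := g (b 0) (b 1) with hF
  set G := g (b 1) (b 1) with hG
  set D := E * G - F * F with hD
  have hD' : E * G - F * F ≠ 0 := hdet
  have hDi : D⁻¹ * D = 1 := inv_mul_cancel₀ hdet
  refine ContinuousLinearMap.IsInvertible.of_inverse (g := D⁻¹ •
    ((G • evalAt (b 0) - F • evalAt (b 1)).smulRight
      (b 0) + (E • evalAt (b 1) -
        F • evalAt (b 0)).smulRight (b 1))) ?_ ?_
  · ext1 ψ
    refine eq_of_apply_basis b ?_ ?_
    · simp [← hE, ← hF, ← hG, ← hsymm]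
      field_simp
      simp only [hD]
      ring
    · simp [← hE, ← hF, ← hG, ← hsymm]
      field_simp
      simp only [hD]
      ring
  · refine eq_of_apply_basis b ?_ ?_
    · simp [← hE, ← hF, ← hG, ← hsymm]
      rw [show G * E - F * F = D by rw [hD]; ring, show E * F - F * E = 0 by ring]
      simp [smul_smul, hDi]
    · simp [← hE, ← hF, ← hG, ← hsymm]
      rw [show E * G - F * F = D by rw [hD], show G * F - F * G = 0 by ring]
      simp [smul_smul, hDi]

/-- Negating one vector of a positive basis keeps the Gram determinant and changes the sign of the
coordinate determinant. -/
theorem volForm_neg (g : T →L[ℝ] T →L[ℝ] ℝ) (o : Orientation ℝ T (Fin 2)) :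
    volForm g (-o) = -volForm g o := by
  set b := posBasis o with hbdef
  have hb : b.orientation = o := posBasis_orientation o
  set c := b.unitsSMul (Function.update 1 1 (-1)) with hcdef
  have hc : c.orientation = -o := by
    rw [hcdef, Module.Basis.orientation_neg_single, hb]
  have c0 : c 0 = b 0 := by simp [hcdef, Module.Basis.unitsSMul_apply]
  have c1 : c 1 = -b 1 := by simp [hcdef, Module.Basis.unitsSMul_apply]
  have k0 : ∀ v, c.coord 0 v = b.coord 0 v := by
    intro v
    conv_lhs => rw [← basis_repr_eq b v, ← c0, show b 1 = -c 1 by rw [c1, neg_neg]]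
    simp
  have k1 : ∀ v, c.coord 1 v = -b.coord 1 v := by
    intro v
    conv_lhs => rw [← basis_repr_eq b v, ← c0, show b 1 = -c 1 by rw [c1, neg_neg]]
    simp
  ext v w
  rw [neg_apply, neg_apply, volForm_apply g c hc, volForm_apply g b hb, k0, k0, k1, k1, c0, c1]
  simp only [map_neg, neg_apply]
  ring_nf

theorem hodge_neg {F : Type*} [AddCommGroup F] [Module ℝ F] [TopologicalSpace F]
    [IsTopologicalAddGroup F] (g : T →L[ℝ] T →L[ℝ] ℝ) (o : Orientation ℝ T (Fin 2))
    (α : T →L[ℝ] F) : hodge g (-o) α = -hodge g o α := by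
  simp [hodge, rot, volForm_neg]

/-- The Hodge star in terms of an arbitrary positively oriented basis. -/
theorem hodge_apply_basis {F : Type*} [AddCommGroup F] [Module ℝ F] [TopologicalSpace F]
    [IsTopologicalAddGroup F] (g : T →L[ℝ] T →L[ℝ] ℝ) {o : Orientation ℝ T (Fin 2)}
    (b : Module.Basis (Fin 2) ℝ T) (hb : b.orientation = o)
    (hsymm : g (b 0) (b 1) = g (b 1) (b 0))
    (hdet : g (b 0) (b 0) * g (b 1) (b 1) - g (b 0) (b 1) * g (b 0) (b 1) ≠ 0)
    (α : T →L[ℝ] F) :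
    hodge g o α (b 0) =
        (√|g (b 0) (b 0) * g (b 1) (b 1) - g (b 0) (b 1) * g (b 0) (b 1)| /
          (g (b 0) (b 0) * g (b 1) (b 1) - g (b 0) (b 1) * g (b 0) (b 1))) •
        (g (b 0) (b 1) • α (b 0) - g (b 0) (b 0) • α (b 1)) ∧
    hodge g o α (b 1) =
        (√|g (b 0) (b 0) * g (b 1) (b 1) - g (b 0) (b 1) * g (b 0) (b 1)| /
          (g (b 0) (b 0) * g (b 1) (b 1) - g (b 0) (b 1) * g (b 0) (b 1))) •
        (g (b 1) (b 1) • α (b 0) - g (b 0) (b 1) • α (b 1)) := by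
  have hinv := isInvertible_of_gram_ne_zero g b hsymm hdet
  set D := g (b 0) (b 0) * g (b 1) (b 1) - g (b 0) (b 1) * g (b 0) (b 1) with hD
  have hvol := volForm_apply g b hb
  rw [← hsymm, ← hD] at hvol
  -- `rot` is found by guessing its value and checking g (J v) = vol v on the basis, which avoids
  -- inverting g explicitly.
  have r0 : rot g o (b 0) = -((√|D| / D) • (g (b 0) (b 1) • b 0 - g (b 0) (b 0) • b 1)) := by
    rw [rot, ContinuousLinearMap.comp_apply, hinv.inverse_apply_eq]
    refine eq_of_apply_basis b ?_ ?_
    · rw [hvol]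
      simp [← hsymm]
      right; ring
    · rw [hvol]
      simp [← hsymm]
      field_simp
      rw [hD]; ring
  have r1 : rot g o (b 1) = -((√|D| / D) • (g (b 1) (b 1) • b 0 - g (b 0) (b 1) • b 1)) := by
    rw [rot, ContinuousLinearMap.comp_apply, hinv.inverse_apply_eq]
    refine eq_of_apply_basis b ?_ ?_
    · rw [hvol]
      simp [← hsymm]
      field_simp
      rw [hD]; ring
    · rw [hvol]
      simp [← hsymm]
      right; ring
  constructor
  · simp [hodge, r0]
  · simp [hodge, r1]

/-- The basis `b` is positively oriented and `g`-orthonormal, with `g (b 1) (b 1)` equal to the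
frame sign. -/
structure IsOrthonormalFrame (K : Kind) (g : T →L[ℝ] T →L[ℝ] ℝ) (o : Orientation ℝ T (Fin 2))
    (b : Module.Basis (Fin 2) ℝ T) : Prop where
  orientation : b.orientation = o
  apply_zero_zero : g (b 0) (b 0) = 1
  apply_zero_one : g (b 0) (b 1) = 0
  apply_one_zero : g (b 1) (b 0) = 0
  apply_one_one : g (b 1) (b 1) = K.frameSign

/-- In the dual coframe this is *ω¹ = ω², *ω² = -ε ω¹, with ε the frame sign: the convention of the
theorem in both signatures. -/
theorem IsOrthonormalFrame.hodge_apply {F : Type*} [AddCommGroup F] [Module ℝ F]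
    [TopologicalSpace F] [IsTopologicalAddGroup F] {K : Kind} {g : T →L[ℝ] T →L[ℝ] ℝ}
    {o : Orientation ℝ T (Fin 2)} {b : Module.Basis (Fin 2) ℝ T} (h : IsOrthonormalFrame K g o b)
    (α : T →L[ℝ] F) :
    hodge g o α (b 0) = -(K.frameSign • α (b 1)) ∧ hodge g o α (b 1) = α (b 0) := by
  have hdet : g (b 0) (b 0) * g (b 1) (b 1) - g (b 0) (b 1) * g (b 0) (b 1) ≠ 0 := by
    rw [h.apply_zero_zero, h.apply_one_one, h.apply_zero_one]
    simpa using K.frameSign_ne_zero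
  have hs : K.frameSign⁻¹ = K.frameSign := 
    (eq_inv_of_mul_eq_one_left K.frameSign_mul_self).symm
  have := hodge_apply_basis g b h.orientation (h.apply_zero_one.trans h.apply_one_zero.symm) hdet α
  simpa [h.apply_zero_zero, h.apply_one_one, h.apply_zero_one, K.abs_frameSign, hs, smul_smul,
    K.frameSign_mul_self] using this

/-- Trace of one bilinear form with respect to another one in an orthogonal basis. -/
theorem trace_inverse_comp (g h : T →L[ℝ] T →L[ℝ] ℝ) (b : Module.Basis (Fin 2) ℝ T)
    (h01 : g (b 0) (b 1) = 0) (h10 : g (b 1) (b 0) = 0) (h00 : g (b 0) (b 0) ≠ 0)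
    (h11 : g (b 1) (b 1) ≠ 0) :
    LinearMap.trace ℝ T (g.inverse ∘L h).toLinearMap =
      (g (b 0) (b 0))⁻¹ * h (b 0) (b 0) + (g (b 1) (b 1))⁻¹ * h (b 1) (b 1) := by
  have hinv := isInvertible_of_gram_ne_zero g b (h01.trans h10.symm) (by simp [h01, h00, h11])
  have key : ∀ ψ : T →L[ℝ] ℝ, g.inverse ψ =
      ((g (b 0) (b 0))⁻¹ * ψ (b 0)) • b 0 + ((g (b 1) (b 1))⁻¹ * ψ (b 1)) • b 1 := by
    intro ψ
    rw [hinv.inverse_apply_eq]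
    refine eq_of_apply_basis b ?_ ?_
    · simp [h10]; field_simp
    · simp [h01]; field_simp
  rw [LinearMap.trace_eq_matrix_trace ℝ b, Matrix.trace_fin_two]
  simp [LinearMap.toMatrix_apply, key]

/-- Gram–Schmidt, starting from a vector of positive square. In the Lorentzian case the second
vector is a timelike u minus its component along the spacelike v, which only lowers its square and
so keeps it timelike. -/
theorem exists_isOrthonormalFrame (K : Kind) (g : T →L[ℝ] T →L[ℝ] ℝ)
    (hsymm : ∀ v w, g v w = g w v) (hg : K.HasSignature g) (o : Orientation ℝ T (Fin 2)) :
    ∃ b, IsOrthonormalFrame K g o b := by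
  have hrank : Module.finrank ℝ T = 2 := Fact.out
  obtain ⟨v, w, hv, hvw, hw⟩ : ∃ v w, 0 < g v v ∧ g v w = 0 ∧ 0 < K.frameSign * g w w := by
    have hpos : (∀ v, v ≠ 0 → 0 < g v v) → K.frameSign = 1 →
        ∃ v w, 0 < g v v ∧ g v w = 0 ∧ 0 < K.frameSign * g w w := by
      intro h hK
      let b := posBasis o
      have hv := h (b 0) (b.ne_zero 0)
      refine ⟨b 0, b 1 - (g (b 0) (b 1) / g (b 0) (b 0)) • b 0, hv, ?_, ?_⟩
      · simp [hv.ne']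
      · rw [hK, one_mul]
        refine h _ fun h0 => ?_
        have := congrArg (b.coord 1) h0
        simp at this
    cases K with
    | euclidean => exact hpos hg rfl
    | spacelike => exact hpos hg rfl
    | timelike =>
      obtain ⟨⟨v, hv⟩, u, hu⟩ := hg
      refine ⟨v, u - (g v u / g v v) • v, hv, by simp [hv.ne'], ?_⟩
      have : g (u - (g v u / g v v) • v) (u - (g v u / g v v) • v) = g u u - g v u ^ 2 / g v v := by
        simp [hsymm u v]
        field_simp
        ring
      rw [this, Kind.frameSign]
      have : 0 ≤ g v u ^ 2 / g v v := by positivity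
      linarith
  have hlin : LinearIndependent ℝ ![v, w] := by
    rw [LinearIndependent.pair_iff]
    intro s t hst
    have h1 : g v (s • v + t • w) = 0 := by rw [hst, map_zero]
    have h2 : g w (s • v + t • w) = 0 := by rw [hst, map_zero]
    simp [hvw, hsymm w v, hv.ne'] at h1 h2
    refine ⟨h1, h2.resolve_right fun h => ?_⟩
    simp [h] at hw
  set e : Module.Basis (Fin 2) ℝ T :=
    basisOfLinearIndependentOfCardEqFinrank hlin (by simp [hrank]) with he
  have e0 : e 0 = v := by simp [he]
  have e1 : e 1 = w := by simp [he]
  have hw' : g w w ≠ 0 := fun h => by simp [h] at hw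
  have habs : K.frameSign * |g w w| = g w w := by
    have : K.frameSign * g w w = |g w w| := by
      rw [← abs_of_pos hw, abs_mul, K.abs_frameSign, one_mul]
    rw [← this, ← mul_assoc, K.frameSign_mul_self, one_mul]
  have hu0 : IsUnit (√(g v v))⁻¹ := by
    rw [isUnit_iff_ne_zero]; exact inv_ne_zero (Real.sqrt_ne_zero'.2 hv)
  have hu1 : IsUnit (√|g w w|)⁻¹ := by
    rw [isUnit_iff_ne_zero]; exact inv_ne_zero (Real.sqrt_ne_zero'.2 (abs_pos.2 hw'))
  set f := e.isUnitSMul (w := ![(√(g v v))⁻¹, (√|g w w|)⁻¹])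
    (by intro i; fin_cases i; exacts [hu0, hu1]) with hf
  have f0 : f 0 = (√(g v v))⁻¹ • v := by simp [hf, Module.Basis.isUnitSMul_apply, e0]
  have f1 : f 1 = (√|g w w|)⁻¹ • w := by simp [hf, Module.Basis.isUnitSMul_apply, e1]
  have g00 : g (f 0) (f 0) = 1 := by
    rw [f0]; simp
    rw [← mul_assoc, ← mul_inv, Real.mul_self_sqrt hv.le, inv_mul_cancel₀ hv.ne']
  have g11 : g (f 1) (f 1) = K.frameSign := by
    rw [f1]; simp
    rw [← mul_assoc, ← mul_inv, Real.mul_self_sqrt (abs_nonneg _)]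
    nth_rewrite 2 [← habs]
    field_simp [abs_ne_zero.2 hw']
  have g01 : g (f 0) (f 1) = 0 := by rw [f0, f1]; simp [hvw]
  have g10 : g (f 1) (f 0) = 0 := by rw [hsymm, g01]
  -- Adjusting to the orientation changes basis vectors only by signs, which an orthogonal Gram
  -- matrix does not see.
  refine ⟨f.adjustToOrientation o, f.orientation_adjustToOrientation o, ?_, ?_, ?_, ?_⟩ <;>
  rcases f.adjustToOrientation_apply_eq_or_eq_neg o 0 with h0 | h0 <;>
  rcases f.adjustToOrientation_apply_eq_or_eq_neg o 1 with h1 | h1 <;>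
  simp [h0, h1, g00, g11, g01, g10]

/-- The determinant is ε in an orthonormal frame and changes by the square of the transition
determinant. -/
theorem gram_det_ne_zero {K : Kind} {g : T →L[ℝ] T →L[ℝ] ℝ} (hsymm : ∀ v w, g v w = g w v)
    (hg : K.HasSignature g) (c : Module.Basis (Fin 2) ℝ T) :
    g (c 0) (c 0) * g (c 1) (c 1) - g (c 0) (c 1) * g (c 0) (c 1) ≠ 0 := by
  obtain ⟨b, hb⟩ := exists_isOrthonormalFrame K g hsymm hg c.orientation
  have h := gram_det_change g b c
  rw [hb.apply_zero_zero, hb.apply_one_one, hb.apply_zero_one, hsymm (c 1) (c 0)] at h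
  rw [h]
  simpa [K.frameSign_ne_zero] using (b.isUnit_det c).ne_zero

end Plane

/-! ### The 1-form dn + n × *dn at a point -/

section Plane

variable {T : Type*} [AddCommGroup T] [Module ℝ T] [TopologicalSpace T]
  [IsTopologicalAddGroup T] [ContinuousSMul ℝ T] [T2Space T]
  [FiniteDimensional ℝ T] [Fact (Module.finrank ℝ T = 2)]
  {K : Kind} {g : T →L[ℝ] T →L[ℝ] ℝ} {o : Orientation ℝ T (Fin 2)}
  {b : Module.Basis (Fin 2) ℝ T}

/-- The normal vector of an orthonormal frame acts on the tangent plane as a rotation. -/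
theorem Kind.cross_normal {E₀ E₁ n : R3} (h00 : K.form E₀ E₀ = 1) (h01 : K.form E₀ E₁ = 0)
    (h11 : K.form E₁ E₁ = K.frameSign) (hn : n = K.gaussSign • K.cross E₀ E₁) :
    K.cross n E₀ = E₁ ∧ K.cross n E₁ = -(K.frameSign • E₀) ∧ K.form n E₀ = 0 ∧ K.form n E₁ = 0 ∧
      K.form n n = K.normalSign := by
  have hδ := K.ambientSign_mul_self
  have c0 : K.cross n E₀ = E₁ := by
    rw [hn, K.gaussSign_eq, K.cross_smul_left, K.cross_anticomm, K.cross_cross, h00, h01]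
    simp [smul_smul, hδ]
  have c1 : K.cross n E₁ = -(K.frameSign • E₀) := by
    rw [hn, K.gaussSign_eq, K.cross_smul_left, K.cross_anticomm, K.cross_cross,
      K.form_comm E₁ E₀, h01, h11]
    simp [smul_smul, ← mul_assoc, hδ]
  have n0 : K.form n E₀ = 0 := by
    rw [hn, map_smul, smul_apply, K.form_comm, K.form_self_cross, smul_zero]
  have n1 : K.form n E₁ = 0 := by
    rw [hn, map_smul, smul_apply, K.form_comm, K.cross_anticomm, map_neg, K.form_self_cross,
      neg_zero, smul_zero]
  refine ⟨c0, c1, n0, n1, ?_⟩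
  have h : K.form n n = K.gaussSign * K.form n (K.cross E₀ E₁) := by
    conv_lhs => rhs; rw [hn]
    rw [map_smul, smul_eq_mul]
  rw [h, K.cross_anticomm, map_neg, K.form_comm, K.form_cross_left, K.cross_anticomm E₁ n, c1,
    K.gaussSign_eq]
  simp only [map_neg, map_smul, neg_neg, h00, smul_eq_mul, mul_one]
  rw [← K.ambientSign_mul_normalSign, ← mul_assoc, hδ, one_mul]

/-- The representation formula at a point: if `A = dx` and `B = dn`, then
`dn + n × *dn = -2H dx`. -/
theorem IsOrthonormalFrame.add_cross_hodge_eq (hb : IsOrthonormalFrame K g o b)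
    {A B : T →L[ℝ] R3} {n : R3} {H : ℝ} (hA : ∀ v w, g v w = K.form (A v) (A w))
    (hn : n = K.gaussSign • K.cross (A (b 0)) (A (b 1))) (hB : ∀ v, K.form n (B v) = 0)
    (hII : ∀ v w, K.form (A v) (B w) = K.form (A w) (B v))
    (hH : K.form (A (b 0)) (B (b 0)) + K.frameSign * K.form (A (b 1)) (B (b 1)) = -(2 * H)) :
    B + K.cross n ∘L hodge g o B = (-(2 * H)) • A := by
  have h00 := (hA _ _).symm.trans hb.apply_zero_zero
  have h01 := (hA _ _).symm.trans hb.apply_zero_one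
  have h10 := (hA _ _).symm.trans hb.apply_one_zero
  have h11 := (hA _ _).symm.trans hb.apply_one_one
  obtain ⟨c0, c1, n0, n1, nn⟩ := K.cross_normal h00 h01 h11 hn
  obtain ⟨s0, s1⟩ := hb.hodge_apply B
  have hε := K.frameSign_mul_self
  have hδ := K.ambientSign_mul_self
  have hcross : K.cross (A (b 0)) (A (b 1)) = K.ambientSign • n := by
    rw [hn, K.gaussSign_eq, smul_smul, hδ, one_smul]
  have hδ0 : K.ambientSign ≠ 0 := fun h => by simp [h] at hδ
  have key : ∀ z : R3, K.form z (A (b 0)) = 0 → K.form z (A (b 1)) = 0 → K.form z n = 0 →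
      z = 0 := by
    intro z h0 h1 h2
    refine K.eq_zero_of_form_eq_zero h0 h1 ?_ ?_
    · rw [hcross, map_smul, h2, smul_zero]
    · rw [hcross]
      simp [nn, hδ0, K.normalSign_ne_zero]
  have hnA : ∀ v, K.form (K.cross n v) n = 0 := fun v => by
    rw [K.form_comm, K.form_self_cross]
  have hII' := hII (b 0) (b 1)
  refine eq_of_apply_basis b ?_ ?_
  -- The difference is paired with A (b 0), A (b 1) and n. Of the two tangential pairings, one is
  -- the trace condition `hH`, the other the symmetry `hII`; the normal one vanishes because both
  -- sides are tangential.
  · rw [← sub_eq_zero]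
    refine key _ ?_ ?_ ?_
    · simp only [add_apply, ContinuousLinearMap.comp_apply, smul_apply, s0, map_sub, map_add,
        map_neg, map_smul, sub_apply, neg_apply, K.form_cross_left, c0, h00, smul_eq_mul,
        K.form_comm (B _) (A _)]
      linear_combination hH
    · simp only [add_apply, ContinuousLinearMap.comp_apply, smul_apply, s0, map_sub, map_add,
        map_neg, map_smul, sub_apply, neg_apply, K.form_cross_left, c1, h01, smul_eq_mul,
        K.form_comm (B _) (A _)]
      linear_combination -hII' - K.form (A (b 0)) (B (b 1)) * hε
    · simp only [add_apply, ContinuousLinearMap.comp_apply, smul_apply, s0, map_sub, map_add,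
        map_neg, map_smul, sub_apply, neg_apply, hnA, smul_eq_mul, K.form_comm _ n, hB, n0]
      simp [K.form_self_cross]
  · rw [← sub_eq_zero]
    refine key _ ?_ ?_ ?_
    · simp only [add_apply, ContinuousLinearMap.comp_apply, smul_apply, s1, map_sub, map_add,
        map_neg, map_smul, sub_apply, neg_apply, K.form_cross_left, c0, h10, smul_eq_mul,
        K.form_comm (B _) (A _)]
      linear_combination hII'
    · simp only [add_apply, ContinuousLinearMap.comp_apply, smul_apply, s1, map_sub, map_add,
        map_neg, map_smul, sub_apply, neg_apply, K.form_cross_left, c1, h11, smul_eq_mul,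
        K.form_comm (B _) (A _)]
      linear_combination K.frameSign * hH - K.form (A (b 1)) (B (b 1)) * hε
    · simp only [add_apply, ContinuousLinearMap.comp_apply, smul_apply, s1, map_sub, map_add,
        map_neg, map_smul, sub_apply, neg_apply, hnA, smul_eq_mul, K.form_comm _ n, hB, n1]
      simp [K.form_self_cross]

/-- The properties at a point of the 1-form `η = B + n × *B` where `B = dn`. -/
structure IsConformalAt (K : Kind) (g : T →L[ℝ] T →L[ℝ] ℝ) (o : Orientation ℝ T (Fin 2)) (n : R3)
    (B η : T →L[ℝ] R3) (c : ℝ) : Prop where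
  normal : ∀ v, K.form n (η v) = 0
  form_eq : ∀ v w, K.form (η v) (η w) = c * g v w
  cross_eq : ∀ b, IsOrthonormalFrame K g o b →
    K.cross (η (b 0)) (η (b 1)) = (K.ambientSign * c) • n
  trace_eq : ∀ b, IsOrthonormalFrame K g o b →
    K.form (η (b 0)) (B (b 0)) + K.frameSign * K.form (η (b 1)) (B (b 1)) = c

/-- The source is n × η(b 0) = η(b 1). As n × _ is skew-adjoint with square -ε on the complement of
n, it makes η(b 0), η(b 1) orthogonal with squares in ratio ε, and Lagrange's formula gives their
product. The factor is read off in one frame; conformality then shows that every frame gives the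
same value. -/
theorem IsOrthonormalFrame.isConformalAt (hb : IsOrthonormalFrame K g o b) {n : R3}
    {B : T →L[ℝ] R3} (hn : K.form n n = K.normalSign) (hB : ∀ v, K.form n (B v) = 0) :
    IsConformalAt K g o n B (B + K.cross n ∘L hodge g o B)
      (K.form ((B + K.cross n ∘L hodge g o B) (b 0)) ((B + K.cross n ∘L hodge g o B) (b 0))) := by
  set η := B + K.cross n ∘L hodge g o B with hη
  have hε := K.frameSign_mul_self
  have hδν := K.ambientSign_mul_normalSign
  have hRR : ∀ v, K.form n v = 0 → K.cross n (K.cross n v) = -(K.frameSign • v) := by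
    intro v hv
    rw [K.cross_cross, hv, hn, zero_smul, zero_sub, smul_neg, smul_smul, hδν]
  have frame : ∀ c, IsOrthonormalFrame K g o c →
      K.form (η (c 0)) (η (c 1)) = 0 ∧
      K.form (η (c 1)) (η (c 1)) = K.frameSign * K.form (η (c 0)) (η (c 0)) ∧
      K.cross (η (c 0)) (η (c 1)) = (K.ambientSign * K.form (η (c 0)) (η (c 0))) • n ∧
      K.form (η (c 0)) (B (c 0)) + K.frameSign * K.form (η (c 1)) (B (c 1)) =
        K.form (η (c 0)) (η (c 0)) := by
    intro c hc
    obtain ⟨s0, s1⟩ := hc.hodge_apply B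
    have e0 : η (c 0) = B (c 0) - K.frameSign • K.cross n (B (c 1)) := by
      simp [hη, s0, sub_eq_add_neg]
    have e1 : η (c 1) = B (c 1) + K.cross n (B (c 0)) := by
      simp [hη, s1]
    have hne : K.form n (η (c 0)) = 0 := by
      rw [e0, map_sub, map_smul, hB, K.form_self_cross]; simp
    have r0 : K.cross n (η (c 0)) = η (c 1) := by
      rw [e0, e1, map_sub, map_smul, hRR _ (hB _), smul_neg, smul_smul, hε, one_smul]
      abel
    refine ⟨?_, ?_, ?_, ?_⟩
    · rw [← r0, K.form_comm, K.form_cross_left]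
      have := K.form_cross_left n (η (c 0)) (η (c 0))
      rw [K.form_comm] at this
      linarith
    · conv_lhs => rw [← r0, K.form_cross_left, hRR _ hne]
      simp
    · rw [← r0, K.cross_cross, K.form_comm _ n, hne]
      simp [smul_smul]
    · have k := K.form_cross_left n (B (c 1)) (B (c 0))
      have k1 := K.form_comm (B (c 1)) (K.cross n (B (c 0)))
      have k2 : K.form (K.cross n (B (c 1))) (K.cross n (B (c 1))) =
          K.frameSign * K.form (B (c 1)) (B (c 1)) := by
        rw [K.form_cross_left, hRR _ (hB _)]; simp
      rw [e0, e1]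
      simp only [map_sub, map_add, map_smul, sub_apply, add_apply, smul_apply, smul_eq_mul, k2,
        K.form_comm (B (c 0)) (K.cross n (B (c 1)))]
      linear_combination K.frameSign * k - K.frameSign * k1 -
        K.frameSign * K.form (B (c 1)) (B (c 1)) * hε
  have hform : ∀ v w, K.form (η v) (η w) = K.form (η (b 0)) (η (b 0)) * g v w := by
    intro v w
    obtain ⟨h01, h11, -, -⟩ := frame b hb
    rw [form_expand g b v w, hb.apply_zero_zero, hb.apply_zero_one, hb.apply_one_zero,
      hb.apply_one_one]
    conv_lhs => rw [← basis_repr_eq b v, ← basis_repr_eq b w]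
    simp only [map_add, map_smul, add_apply, smul_apply, smul_eq_mul, h11, h01,
      K.form_comm (η (b 1)) (η (b 0))]
    ring
  have hc : ∀ c, IsOrthonormalFrame K g o c →
      K.form (η (c 0)) (η (c 0)) = K.form (η (b 0)) (η (b 0)) := by
    intro c hc
    rw [hform, hc.apply_zero_zero, mul_one]
  refine ⟨fun v => ?_, hform, fun c h => ?_, fun c h => ?_⟩
  · simp [hη, hB, K.form_self_cross]
  · rw [(frame c h).2.2.1, hc c h]
  · rw [(frame c h).2.2.2, hc c h]

/-- The vector product of `B` and `*B` vanishes. -/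
theorem IsOrthonormalFrame.cross_hodge_antisymm (hb : IsOrthonormalFrame K g o b)
    (B : T →L[ℝ] R3) (v w : T) :
    K.cross (B v) (hodge g o B w) = K.cross (B w) (hodge g o B v) := by
  obtain ⟨s0, s1⟩ := hb.hodge_apply B
  have h0 : K.cross (B (b 0)) (B (b 0)) = 0 := K.cross_self _
  have h1 : K.cross (B (b 1)) (B (b 1)) = 0 := K.cross_self _
  -- Up to a scalar, * exchanges the values on the two frame vectors, so the mixed terms are
  -- products of a vector with itself and vanish.
  rw [← basis_repr_eq b v, ← basis_repr_eq b w]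
  simp only [map_add, map_smul, s0, s1, K.cross_add_left, K.cross_smul_left, map_neg, h0, h1]
  module

/-- The complement of a timelike vector in Lorentzian space is spacelike; in Euclidean space there
is nothing to use. -/
theorem Kind.form_pos_of_orthogonal {n v : R3} (hK : K ≠ .timelike)
    (hn : K.form n n = K.normalSign) (hv : K.form n v = 0) (hne : v ≠ 0) : 0 < K.form v v := by
  have hv' : ¬ (v 0 = 0 ∧ v 1 = 0 ∧ v 2 = 0) := fun h' => hne <| by
    ext i; fin_cases i; exacts [h'.1, h'.2.1, h'.2.2]
  cases K with
  | euclidean =>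
    simp only [Kind.form_apply, Kind.ambientSign, one_mul]
    by_contra hcon
    exact hv' ⟨by nlinarith [mul_self_nonneg (v 0), mul_self_nonneg (v 1), mul_self_nonneg (v 2)],
      by nlinarith [mul_self_nonneg (v 0), mul_self_nonneg (v 1), mul_self_nonneg (v 2)],
      by nlinarith [mul_self_nonneg (v 0), mul_self_nonneg (v 1), mul_self_nonneg (v 2)]⟩
  | spacelike =>
    simp only [Kind.form_apply, Kind.ambientSign, Kind.normalSign] at hn hv ⊢
    -- Multiplying by n₃² allows v₃ and n₃ to be eliminated through `hn` and `hv`; Lagrange's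
    -- identity in the plane then gives a sum of squares.
    have key : (v 0 * v 0 + v 1 * v 1 + -1 * (v 2 * v 2)) * (n 2 * n 2) =
        v 0 * v 0 + v 1 * v 1 + (n 0 * v 1 - n 1 * v 0) ^ 2 := by
      have e1 : n 2 * n 2 = 1 + n 0 * n 0 + n 1 * n 1 := by linarith
      have e2 : n 2 * v 2 = n 0 * v 0 + n 1 * v 1 := by linarith
      calc _ = (v 0 * v 0 + v 1 * v 1) * (n 2 * n 2) - (n 2 * v 2) * (n 2 * v 2) := by ring
        _ = _ := by rw [e1, e2]; ring
    have hn2 : 0 < n 2 * n 2 := by nlinarith [mul_self_nonneg (n 0), mul_self_nonneg (n 1)]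
    have hvv : 0 < v 0 * v 0 + v 1 * v 1 := by
      rcases eq_or_ne (v 0) 0 with h0 | h0
      · rcases eq_or_ne (v 1) 0 with h1 | h1
        · refine absurd ⟨h0, h1, ?_⟩ hv'
          have : n 2 * v 2 = 0 := by rw [h0, h1] at hv; linarith
          rcases mul_eq_zero.1 this with h2 | h2
          · simp [h2] at hn2
          · exact h2
        · nlinarith [mul_self_nonneg (v 0), mul_self_pos.2 h1]
      · nlinarith [mul_self_nonneg (v 1), mul_self_pos.2 h0]
    have : 0 < (v 0 * v 0 + v 1 * v 1 + -1 * (v 2 * v 2)) * (n 2 * n 2) := by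
      rw [key]; positivity
    exact (pos_iff_pos_of_mul_pos this).2 hn2
  | timelike => exact absurd rfl hK

theorem IsConformalAt.pos {n : R3} {B η : T →L[ℝ] R3} {c : ℝ} (h : IsConformalAt K g o n B η c)
    (hK : K ≠ .timelike) (hg : ∀ v, v ≠ 0 → 0 < g v v) (hn : K.form n n = K.normalSign)
    (hη : η ≠ 0) : 0 < c := by
  obtain ⟨v, hv⟩ : ∃ v, η v ≠ 0 := by
    by_contra! hcon
    exact hη (ContinuousLinearMap.ext hcon)
  have hpos := K.form_pos_of_orthogonal hK hn (h.normal v) hv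
  rw [h.form_eq] at hpos
  exact (pos_iff_pos_of_mul_pos hpos).2 (hg v fun h0 => hv (by rw [h0, map_zero]))

/-- If c = 0, then η(b 0) × η(b 1) = 0, so the two images are parallel and η has a kernel. -/
theorem IsConformalAt.ne_zero {n : R3} {B η : T →L[ℝ] R3} {c : ℝ} (h : IsConformalAt K g o n B η c)
    (hb : IsOrthonormalFrame K g o b) (hη : ∀ v, v ≠ 0 → η v ≠ 0) : c ≠ 0 := by
  rintro rfl
  have hδ0 : K.ambientSign ≠ 0 := fun h => by simpa [h] using K.ambientSign_mul_self
  have hcr := h.cross_eq b hb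
  set u := η (b 0) with hu
  set w := η (b 1) with hw
  rw [K.cross_apply, mul_zero, zero_smul] at hcr
  have m0 : u 1 * w 2 - w 1 * u 2 = 0 := congrFun hcr 0
  have m1 : u 2 * w 0 - w 2 * u 0 = 0 := congrFun hcr 1
  have m2 : u 0 * w 1 - w 0 * u 1 = 0 :=
    (mul_eq_zero.1 (show K.ambientSign * (u 0 * w 1 - w 0 * u 1) = 0
      from congrFun hcr 2)).resolve_left hδ0
  have key : ∀ i, u i = 0 := by
    intro i
    by_contra hi
    -- The image of this vector is u i • w - w i • u, which is zero for parallel u and w.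
    refine hη (u i • b 1 - w i • b 0) (fun h0 => hi ?_) ?_
    · have := congrArg (b.coord 1) h0
      simpa using this
    · rw [map_sub, map_smul, map_smul, ← hu, ← hw]
      ext j
      fin_cases i <;> fin_cases j <;> simp <;> linarith
  exact hη (b 0) (b.ne_zero 0) (funext key)

end Plane

/-! ### Gluing local primitives -/

/-- On a simply connected space, functions given locally up to locally constant functions
come from a global function. -/
theorem exists_global_of_locally_constant_sub {X F : Type*} [TopologicalSpace X]
    [SimplyConnectedSpace X] [LocallyPathConnectedSpace X] [AddCommGroup F] (U : X → Set X)
    (hU : ∀ i, IsOpen (U i)) (hmem : ∀ x, x ∈ U x) (f : X → X → F)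
    (hf : ∀ i j, ∀ x ∈ U i ∩ U j, ∀ᶠ z in 𝓝 x, f i z - f j z = f i x - f j x) :
    ∃ y : X → F, ∀ x, ∀ᶠ z in 𝓝 x, y z - f x z = y x - f x x := by
  let _ : TopologicalSpace F := ⊥
  have : DiscreteTopology F := ⟨rfl⟩
  -- The fibre coordinate over `U i` is the difference between the sought function and `f i`. The
  -- transition functions are locally constant, so with discrete fibre this is a covering of X; a
  -- lift of the identity is a global section, and adding back `f x x` gives y.
  let Z : FiberBundleCore X X F :=
    { baseSet := U
      isOpen_baseSet := hU
      indexAt := id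
      mem_baseSet_at := hmem
      coordChange := fun i j x v => v + f i x - f j x
      coordChange_self := fun i x _ v => by abel
      continuousOn_coordChange := by
        rintro i j ⟨x, v⟩ ⟨hx, -⟩
        refine ContinuousAt.continuousWithinAt ?_
        have h1 : ∀ᶠ p : X × F in 𝓝 (x, v), f i p.1 - f j p.1 = f i x - f j x :=
          (continuous_fst.continuousAt (x := (x, v))).eventually (hf i j x hx)
        have h2 : ∀ᶠ p : X × F in 𝓝 (x, v), p.2 = v :=
          (continuous_snd.continuousAt (x := (x, v))).eventually
            (show ∀ᶠ w in 𝓝 v, w = v by rw [nhds_discrete]; rfl)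
        refine (continuousAt_const (y := v + (f i x - f j x))).congr ?_
        filter_upwards [h1, h2] with p hp1 hp2
        rw [hp2, ← hp1]; abel
      coordChange_comp := fun i j k x _ v => by abel }
  have hcov : IsCoveringMap Z.proj := FiberBundle.isCoveringMap
  obtain ⟨x₀⟩ : Nonempty X := inferInstance
  obtain ⟨s, ⟨-, hs⟩, -⟩ := hcov.existsUnique_continuousMap_lifts (ContinuousMap.id X) x₀
    (⟨x₀, (0 : F)⟩ : Z.TotalSpace) rfl
  have hs' : ∀ x, (s x).proj = x := fun x => congrFun hs x
  let c : X → F := fun x => (s x).snd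
  refine ⟨fun x => c x + f x x, fun x => ?_⟩
  have hcont : ContinuousAt (fun z => (Z.localTriv x (s z)).2) x := by
    refine continuous_snd.continuousAt.comp ?_
    refine ContinuousAt.comp (g := Z.localTriv x) ?_ s.continuous.continuousAt
    refine (Z.localTriv x).continuousAt ?_
    rw [(Z.localTriv x).mem_source]
    change (s x).proj ∈ U x
    rw [hs']
    exact hmem x
  have key : ∀ z, (Z.localTriv x (s z)).2 = c z + f z z - f x z := by
    intro z
    change c z + f (s z).proj (s z).proj - f x (s z).proj = _
    rw [hs']
  have h := hcont.eventually (show ∀ᶠ w in 𝓝 (Z.localTriv x (s x)).2, w = (Z.localTriv x (s x)).2 by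
    rw [nhds_discrete]; rfl)
  filter_upwards [h] with z hz
  rw [key, key] at hz
  exact hz

/-! ### Charts -/

section Charts

variable {M : Type*} [TopologicalSpace M] [ChartedSpace R2 M]

theorem isOpen_target (p : M) : IsOpen (extChartAt (𝓡 2) p).target :=
  isOpen_extChartAt_target p

variable [IsManifold (𝓡 2) ∞ M]

theorem contMDiffAt_chart_symm (p : M) {y : R2} (hy : y ∈ (extChartAt (𝓡 2) p).target) :
    ContMDiffAt 𝓘(ℝ, R2) (𝓡 2) ∞ (extChartAt (𝓡 2) p).symm y :=
  (contMDiffOn_extChartAt_symm p).contMDiffAt ((isOpen_target p).mem_nhds hy)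

theorem mdifferentiableAt_chart_symm (p : M) {y : R2} (hy : y ∈ (extChartAt (𝓡 2) p).target) :
    MDifferentiableAt 𝓘(ℝ, R2) (𝓡 2) (extChartAt (𝓡 2) p).symm y :=
  (contMDiffAt_chart_symm p hy).mdifferentiableAt (by simp)

theorem contDiffOn_comp_chart_symm {F : Type*} [NormedAddCommGroup F] [NormedSpace ℝ F]
    {f : M → F} (p : M) (hf : ContMDiffOn (𝓡 2) 𝓘(ℝ, F) ∞ f (extChartAt (𝓡 2) p).source) :
    ContDiffOn ℝ ∞ (f ∘ (extChartAt (𝓡 2) p).symm) (extChartAt (𝓡 2) p).target := by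
  rw [← contMDiffOn_iff_contDiffOn]
  exact hf.comp (contMDiffOn_extChartAt_symm p) fun y hy => (extChartAt (𝓡 2) p).map_target hy

theorem hasFDerivAt_comp_chart_symm {f : M → R3} (p : M) {y : R2}
    (hy : y ∈ (extChartAt (𝓡 2) p).target)
    (hf : MDifferentiableAt (𝓡 2) 𝓘(ℝ, R3) f ((extChartAt (𝓡 2) p).symm y)) :
    HasFDerivAt (f ∘ (extChartAt (𝓡 2) p).symm) (chartForm (mvfderiv (𝓡 2) f) p y) y := by
  have h := (hf.hasMFDerivAt).comp y (mdifferentiableAt_chart_symm p hy).hasMFDerivAt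
  exact h.hasFDerivAt

/-- A 1-form in the chart around `p`, in terms of the trivialization of the tangent bundle. -/
theorem chartForm_apply (θ : ∀ q : M, TangentSpace (𝓡 2) q →L[ℝ] R3) (p : M) {y : R2}
    (hy : y ∈ (extChartAt (𝓡 2) p).target) (v : R2) :
    chartForm θ p y v = θ ((extChartAt (𝓡 2) p).symm y)
      ((trivializationAt R2 (TangentSpace (𝓡 2) : M → Type _) p).symmL ℝ
        ((extChartAt (𝓡 2) p).symm y) v) := by
  have hq : (extChartAt (𝓡 2) p).symm y ∈ (chartAt R2 p).source := by
    have := (extChartAt (𝓡 2) p).map_target hy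
    rwa [extChartAt_source] at this
  have h1 := TangentBundle.symmL_trivializationAt (I := 𝓡 2) hq
  have h2 : (mfderivWithin 𝓘(ℝ, R2) (𝓡 2) (extChartAt (𝓡 2) p).symm (Set.range (𝓡 2))
      (extChartAt (𝓡 2) p ((extChartAt (𝓡 2) p).symm y)) : R2 →L[ℝ] R2) =
      (mfderiv 𝓘(ℝ, R2) (𝓡 2) (extChartAt (𝓡 2) p).symm y : R2 →L[ℝ] R2) := by
    rw [ModelWithCorners.range_eq_univ, mfderivWithin_univ, (extChartAt (𝓡 2) p).right_inv hy]
  rw [h1]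
  exact congrArg (θ ((extChartAt (𝓡 2) p).symm y)) (DFunLike.congr_fun h2 v).symm

end Charts

/-! ### Closed 1-forms in charts and their primitives -/

section Charts

variable {M : Type*} [TopologicalSpace M] [ChartedSpace R2 M]

theorem form_congr_point (θ : ∀ q : M, TangentSpace (𝓡 2) q →L[ℝ] R3) {a b : M} (h : a = b)
    (w : R2) : θ a w = θ b w := by
  subst h; rfl

theorem tendsto_chart_symm (p : M) {q : M} (hq : q ∈ (extChartAt (𝓡 2) p).source) :
    Filter.Tendsto (extChartAt (𝓡 2) p).symm (𝓝 (extChartAt (𝓡 2) p q)) (𝓝 q) := by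
  have h := continuousAt_extChartAt_symm' (I := 𝓡 2) hq
  rwa [ContinuousAt, (extChartAt (𝓡 2) p).left_inv hq] at h

theorem tendsto_chart (p : M) {q : M} (hq : q ∈ (extChartAt (𝓡 2) p).source) :
    Filter.Tendsto (extChartAt (𝓡 2) p) (𝓝 q) (𝓝 (extChartAt (𝓡 2) p q)) :=
  continuousAt_extChartAt' (I := 𝓡 2) hq

variable [IsManifold (𝓡 2) ∞ M]

theorem chartForm_comp_mfderiv_chart (θ : ∀ q : M, TangentSpace (𝓡 2) q →L[ℝ] R3) (p : M) {q : M}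
    (hq : q ∈ (extChartAt (𝓡 2) p).source) (w : R2) :
    chartForm θ p (extChartAt (𝓡 2) p q) (mfderiv (𝓡 2) 𝓘(ℝ, R2) (extChartAt (𝓡 2) p) q w) =
      θ q w := by
  have h := mfderivWithin_extChartAt_symm_comp_mfderiv_extChartAt' (I := 𝓡 2) hq
  rw [ModelWithCorners.range_eq_univ, mfderivWithin_univ] at h
  have h' := DFunLike.congr_fun h w
  refine Eq.trans ?_ (form_congr_point θ ((extChartAt (𝓡 2) p).left_inv hq) w)
  exact congrArg (θ _) h'

/-- Change of charts for 1-forms. -/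
theorem chartForm_change (θ : ∀ q : M, TangentSpace (𝓡 2) q →L[ℝ] R3) (p q : M) {y : R2}
    (hy : y ∈ (extChartAt (𝓡 2) p).target)
    (hyq : (extChartAt (𝓡 2) p).symm y ∈ (extChartAt (𝓡 2) q).source) :
    chartForm θ p y =
      chartForm θ q (extChartAt (𝓡 2) q ((extChartAt (𝓡 2) p).symm y)) ∘L
        fderiv ℝ (extChartAt (𝓡 2) q ∘ (extChartAt (𝓡 2) p).symm) y := by
  have hd : MDifferentiableAt (𝓡 2) 𝓘(ℝ, R2) (extChartAt (𝓡 2) q) ((extChartAt (𝓡 2) p).symm y) :=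
    mdifferentiableAt_extChartAt (by rwa [extChartAt_source] at hyq)
  have hc := (hd.hasMFDerivAt).comp y (mdifferentiableAt_chart_symm p hy).hasMFDerivAt
  let D : R2 →L[ℝ] R2 :=
    (mfderiv (𝓡 2) 𝓘(ℝ, R2) (extChartAt (𝓡 2) q) ((extChartAt (𝓡 2) p).symm y) : R2 →L[ℝ] R2) ∘L
      (mfderiv 𝓘(ℝ, R2) (𝓡 2) (extChartAt (𝓡 2) p).symm y : R2 →L[ℝ] R2)
  have hc' : HasFDerivAt (extChartAt (𝓡 2) q ∘ (extChartAt (𝓡 2) p).symm) D y := hc.hasFDerivAt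
  rw [hc'.fderiv]
  ext1 v
  exact (chartForm_comp_mfderiv_chart θ q hyq _).symm

theorem contDiffAt_chart_change (p q : M) {y : R2}
    (hy : y ∈ (extChartAt (𝓡 2) p).target)
    (hyq : (extChartAt (𝓡 2) p).symm y ∈ (extChartAt (𝓡 2) q).source) :
    ContDiffAt ℝ ∞ (extChartAt (𝓡 2) q ∘ (extChartAt (𝓡 2) p).symm) y := by
  rw [← contMDiffAt_iff_contDiffAt]
  refine ContMDiffAt.comp (I' := 𝓡 2) y ?_ (contMDiffAt_chart_symm p hy)
  exact contMDiffAt_extChartAt' (by rwa [extChartAt_source] at hyq)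

/-- A closed 1-form is closed in every chart. -/
theorem differentiableAt_chartForm_and_symm (θ : ∀ q : M, TangentSpace (𝓡 2) q →L[ℝ] R3)
    (hdiff : ∀ q, DifferentiableAt ℝ (chartForm θ q) (extChartAt (𝓡 2) q q))
    (hclosed : ∀ q v w, extDerivOne θ q v w = 0) (p : M) {y : R2}
    (hy : y ∈ (extChartAt (𝓡 2) p).target) :
    DifferentiableAt ℝ (chartForm θ p) y ∧
      ∀ v w, fderiv ℝ (chartForm θ p) y v w = fderiv ℝ (chartForm θ p) y w v := by
  -- The hypotheses speak of each chart only at its centre. At another point y of the chart around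
  -- p, one changes to the chart centred at the corresponding point q.
  set q := (extChartAt (𝓡 2) p).symm y with hq
  set ψ := extChartAt (𝓡 2) q ∘ (extChartAt (𝓡 2) p).symm with hψ
  have hψy : ψ y = extChartAt (𝓡 2) q q := rfl
  have hsrc : (extChartAt (𝓡 2) p).symm y ∈ (extChartAt (𝓡 2) q).source :=
    mem_extChartAt_source q
  have hev : chartForm θ p =ᶠ[𝓝 y] fun z => chartForm θ q (ψ z) ∘L fderiv ℝ ψ z := by
    have hcont : ContinuousAt (extChartAt (𝓡 2) p).symm y :=
      (contMDiffAt_chart_symm p hy).continuousAt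
    filter_upwards [(isOpen_target p).mem_nhds hy,
      hcont.preimage_mem_nhds ((isOpen_extChartAt_source q).mem_nhds hsrc)] with z hz hz'
    exact chartForm_change θ p q hz hz'
  have hψd := contDiffAt_chart_change p q hy hsrc
  have hψ1 : HasFDerivAt ψ (fderiv ℝ ψ y) y := (hψd.differentiableAt (by simp)).hasFDerivAt
  have hψ2 : HasFDerivAt (fderiv ℝ ψ) (fderiv ℝ (fderiv ℝ ψ) y) y :=
    ((hψd.fderiv_right (m := 1) (by norm_cast)).differentiableAt (by simp)).hasFDerivAt
  have hsymm : IsSymmSndFDerivAt ℝ ψ y := hψd.isSymmSndFDerivAt (by simp; norm_cast)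
  have hA : HasFDerivAt (chartForm θ q) (fderiv ℝ (chartForm θ q) (ψ y)) (ψ y) :=
    (hdiff q).hasFDerivAt
  have hAψ := hA.comp y hψ1
  have htot := (hAψ.clm_comp hψ2).congr_of_eventuallyEq hev
  refine ⟨htot.differentiableAt, fun v w => ?_⟩
  rw [htot.fderiv]
  -- The derivative of the pulled back form has two terms: one in the second derivative of ψ, which
  -- is symmetric, and one in the derivative of the form at the centre of q, symmetric by
  -- closedness.
  have hcl := hclosed q (fderiv ℝ ψ y v) (fderiv ℝ ψ y w)
  replace hcl : fderiv ℝ (chartForm θ q) (ψ y) (fderiv ℝ ψ y v) (fderiv ℝ ψ y w) =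
      fderiv ℝ (chartForm θ q) (ψ y) (fderiv ℝ ψ y w) (fderiv ℝ ψ y v) := sub_eq_zero.1 hcl
  simp
  rw [hsymm v w, hcl]

/-- Two functions with the same differential differ by a locally constant function. -/
theorem eventually_sub_eq_of_mvfderiv_eq {f h : M → R3} {x : M}
    (hf : ∀ᶠ z in 𝓝 x, MDifferentiableAt (𝓡 2) 𝓘(ℝ, R3) f z)
    (hh : ∀ᶠ z in 𝓝 x, MDifferentiableAt (𝓡 2) 𝓘(ℝ, R3) h z)
    (hfh : ∀ᶠ z in 𝓝 x, mvfderiv (𝓡 2) f z = mvfderiv (𝓡 2) h z) :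
    ∀ᶠ z in 𝓝 x, f z - h z = f x - h x := by
  set φ := extChartAt (𝓡 2) x with hφ
  have hx : x ∈ φ.source := mem_extChartAt_source x
  have hall := (tendsto_chart_symm x hx).eventually (hf.and (hh.and hfh))
  have htar := (isOpen_target x).mem_nhds (mem_extChartAt_target (I := 𝓡 2) x)
  obtain ⟨r, hr, hball⟩ := Metric.mem_nhds_iff.1 (Filter.inter_mem hall htar)
  have hder : ∀ y ∈ Metric.ball (φ x) r,
      HasFDerivAt (fun y => f (φ.symm y) - h (φ.symm y)) (0 : R2 →L[ℝ] R3) y := by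
    intro y hy
    obtain ⟨⟨h1, h2, h3⟩, h4⟩ := hball hy
    have := (hasFDerivAt_comp_chart_symm x h4 h1).sub (hasFDerivAt_comp_chart_symm x h4 h2)
    have e : chartForm (mvfderiv (𝓡 2) f) x y - chartForm (mvfderiv (𝓡 2) h) x y = 0 := by
      rw [chartForm, chartForm, h3, sub_self]
    rw [e] at this
    exact this
  have hconst : ∀ y ∈ Metric.ball (φ x) r, f (φ.symm y) - h (φ.symm y) = f x - h x := by
    intro y hy
    have := (convex_ball (φ x) r).is_const_of_fderivWithin_eq_zero (𝕜 := ℝ)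
      (fun z hz => (hder z hz).differentiableAt.differentiableWithinAt) (fun z hz => by
        rw [fderivWithin_of_isOpen Metric.isOpen_ball hz, (hder z hz).fderiv]) hy
        (Metric.mem_ball_self hr)
    simpa [φ.left_inv hx] using this
  filter_upwards [(tendsto_chart x hx).eventually (Metric.ball_mem_nhds _ hr),
    (isOpen_extChartAt_source x).mem_nhds hx] with z hz hz'
  have := hconst _ hz
  rwa [φ.left_inv hz'] at this

/-- On a simply connected surface, every closed 1-form has a primitive. -/
theorem exists_isPrimitive_of_closed [SimplyConnectedSpace M]
    (θ : ∀ q : M, TangentSpace (𝓡 2) q →L[ℝ] R3)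
    (hdiff : ∀ q, DifferentiableAt ℝ (chartForm θ q) (extChartAt (𝓡 2) q q))
    (hclosed : ∀ q v w, extDerivOne θ q v w = 0) : ∃ y, IsPrimitive θ y := by
  have hlocal : ∀ p : M, ∃ (U : Set M) (f : M → R3), IsOpen U ∧ p ∈ U ∧ ∀ q ∈ U,
      MDifferentiableAt (𝓡 2) 𝓘(ℝ, R3) f q ∧ mvfderiv (𝓡 2) f q = θ q := by
    intro p
    obtain ⟨r, hr, hball⟩ := Metric.mem_nhds_iff.1
      ((isOpen_target p).mem_nhds (mem_extChartAt_target (I := 𝓡 2) p))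
    -- The Poincaré lemma on a ball in the chart.
    obtain ⟨f, hf⟩ := (convex_ball (extChartAt (𝓡 2) p p)
      r).exists_forall_hasFDerivAt_of_fderiv_symmetric
      Metric.isOpen_ball
      (fun y hy => (differentiableAt_chartForm_and_symm θ hdiff hclosed p
        (hball hy)).1.differentiableWithinAt)
      (fun y hy => (differentiableAt_chartForm_and_symm θ hdiff hclosed p (hball hy)).2)
    refine ⟨(extChartAt (𝓡 2) p).source ∩
        extChartAt (𝓡 2) p ⁻¹' Metric.ball (extChartAt (𝓡 2) p p) r,
      f ∘ extChartAt (𝓡 2) p, ?_, ⟨mem_extChartAt_source p, Metric.mem_ball_self hr⟩, ?_⟩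
    · exact (continuousOn_extChartAt p).isOpen_inter_preimage (isOpen_extChartAt_source p)
        Metric.isOpen_ball
    · rintro q ⟨hq, hqr⟩
      have hd : MDifferentiableAt (𝓡 2) 𝓘(ℝ, R2) (extChartAt (𝓡 2) p) q :=
        mdifferentiableAt_extChartAt (by rwa [extChartAt_source] at hq)
      have hm := ((hf _ hqr).hasMFDerivAt).comp q hd.hasMFDerivAt
      refine ⟨hm.mdifferentiableAt, ?_⟩
      ext1 w
      refine Eq.trans ?_ (chartForm_comp_mfderiv_chart θ p hq w)
      exact DFunLike.congr_fun hm.mfderiv w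
  choose U f hU hmem hf using hlocal
  have : LocallyPathConnectedSpace M := ChartedSpace.locallyPathConnectedSpace R2 M
  obtain ⟨y, hy⟩ := exists_global_of_locally_constant_sub U hU hmem f (by
    rintro i j x ⟨hi, hj⟩
    refine eventually_sub_eq_of_mvfderiv_eq ?_ ?_ ?_
    · filter_upwards [(hU i).mem_nhds hi] with z hz using (hf i z hz).1
    · filter_upwards [(hU j).mem_nhds hj] with z hz using (hf j z hz).1
    · filter_upwards [(hU i).mem_nhds hi, (hU j).mem_nhds hj] with z hz hz'
      rw [(hf i z hz).2, (hf j z hz').2])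
  have key : ∀ x, HasMFDerivAt (𝓡 2) 𝓘(ℝ, R3) y x (mfderiv (𝓡 2) 𝓘(ℝ, R3) (f x) x) := by
    intro x
    have h1 := ((hf x x (hmem x)).1.hasMFDerivAt).add
      (hasMFDerivAt_const (I := 𝓡 2) (I' := 𝓘(ℝ, R3)) (y x - f x x) x)
    have h2 : y =ᶠ[𝓝 x] (f x + fun _ => y x - f x x) := by
      filter_upwards [hy x] with z hz
      simp [← hz]
    have h3 := h1.congr_of_eventuallyEq h2
    have h4 := add_zero (mfderiv (𝓡 2) 𝓘(ℝ, R3) (f x) x : R2 →L[ℝ] R3)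
    exact h4 ▸ h3
  refine ⟨y, fun x => (key x).mdifferentiableAt, fun x => ?_⟩
  rw [← (hf x x (hmem x)).2]
  ext1 w
  exact DFunLike.congr_fun (key x).mfderiv w

end Charts

/-! ### Smoothness of *dn and closedness of n × *dn -/

section Smoothness

variable {M : Type*} [TopologicalSpace M] [ChartedSpace R2 M] [IsManifold (𝓡 2) ∞ M]

/-- The coordinate vector field of the chart around `p` with constant coordinates `v`. -/
def coordField (p : M) (v : R2) (q : M) : TangentSpace (𝓡 2) q :=
  (trivializationAt R2 (TangentSpace (𝓡 2) : M → Type _) p).symmL ℝ q v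

theorem mem_baseSet {p q : M} (hq : q ∈ (extChartAt (𝓡 2) p).source) :
    q ∈ (trivializationAt R2 (TangentSpace (𝓡 2) : M → Type _) p).baseSet := by
  rwa [TangentBundle.trivializationAt_baseSet, ← extChartAt_source (𝓡 2)]

theorem contMDiffOn_coordField (p : M) (v : R2) :
    ContMDiffOn (𝓡 2) ((𝓡 2).prod 𝓘(ℝ, R2)) ∞
      (fun q => Bundle.TotalSpace.mk' R2 (E := (TangentSpace (𝓡 2) : M → Type _)) q
        (coordField p v q)) (extChartAt (𝓡 2) p).source := by
  set e := trivializationAt R2 (TangentSpace (𝓡 2) : M → Type _) p with he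
  have : ContMDiffOn (𝓡 2) ((𝓡 2).prod 𝓘(ℝ, R2)) ∞
      (fun q => Bundle.TotalSpace.mk' R2 (E := (TangentSpace (𝓡 2) : M → Type _)) q
        (coordField p v q)) e.baseSet := by
    rw [e.contMDiffOn_section_baseSet_iff]
    refine (contMDiffOn_const (c := v)).congr fun y hy => ?_
    simp [coordField, ← he, hy, Bundle.Trivialization.apply_mk_symm]
  exact this.mono fun q hq => mem_baseSet hq

theorem contMDiffOn_metric_coordField {K : Kind}
    {g : ∀ p : M, TangentSpace (𝓡 2) p →L[ℝ] TangentSpace (𝓡 2) p →L[ℝ] ℝ} (hg : IsMetric K g)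
    (p : M) (v w : R2) :
    ContMDiffOn (𝓡 2) 𝓘(ℝ, ℝ) ∞ (fun q => g q (coordField p v q) (coordField p w q))
      (extChartAt (𝓡 2) p).source := by
  intro q hq
  have h := ContMDiffWithinAt.clm_bundle_apply₂ (F₁ := R2) (F₂ := R2) (F₃ := ℝ)
    (E₃ := Bundle.Trivial M ℝ) (hg.contMDiff.contMDiffOn q hq)
    (contMDiffOn_coordField p v q hq) (contMDiffOn_coordField p w q hq)
  rw [Bundle.contMDiffWithinAt_totalSpace] at h
  exact h.2

/-- The sign s tells whether the coordinate frame is positive or negative. It is one constant near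
p, so it cannot spoil the smoothness of the Hodge star in coordinates. -/
theorem orientation_basis_map {p : M} {o : ∀ p : M, Orientation ℝ (TangentSpace (𝓡 2) p) (Fin 2)}
    (ho : IsOrientation o) (β : Module.Basis (Fin 2) ℝ R2) :
    ∃ s : ℝ, ∀ᶠ q in 𝓝 p, ∃ b : Module.Basis (Fin 2) ℝ (TangentSpace (𝓡 2) q),
      (∀ i, b i = coordField p (β i) q) ∧
        ((s = 1 ∧ b.orientation = o q) ∨ (s = -1 ∧ b.orientation = -o q)) := by
  obtain ⟨o₀, h₀⟩ := ho p
  have hs : ∀ᶠ q in 𝓝 p, q ∈ (extChartAt (𝓡 2) p).source :=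
    (isOpen_extChartAt_source p).mem_nhds (mem_extChartAt_source p)
  have key : ∀ q (hq : q ∈ (trivializationAt R2 (TangentSpace (𝓡 2) : M → Type _) p).baseSet),
      ∃ b : Module.Basis (Fin 2) ℝ (TangentSpace (𝓡 2) q), (∀ i, b i = coordField p (β i) q) ∧
      Orientation.map (Fin 2)
        ((trivializationAt R2 (TangentSpace (𝓡 2) : M → Type _) p).continuousLinearEquivAt
          ℝ q hq).toLinearEquiv b.orientation = β.orientation := by
    intro q hq
    refine ⟨β.map ((trivializationAt R2 (TangentSpace (𝓡 2) : M → Type _) p).continuousLinearEquivAt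
          ℝ q hq).toLinearEquiv.symm, fun i => ?_, ?_⟩
    · rw [Module.Basis.map_apply, coordField, Bundle.Trivialization.symmL_apply _ hq]
      rfl
    · rw [← Module.Basis.orientation_map]
      congr 1
      refine Module.Basis.eq_of_apply_eq fun i => ?_
      rw [Module.Basis.map_apply, Module.Basis.map_apply, LinearEquiv.apply_symm_apply]
  rcases Orientation.eq_or_eq_neg β.orientation o₀ (by simp) with hβ | hβ
  · refine ⟨1, ?_⟩
    filter_upwards [h₀, hs] with q hq hqs
    obtain ⟨b, hb, hbo⟩ := key q (mem_baseSet hqs)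
    refine ⟨b, hb, Or.inl ⟨rfl, ?_⟩⟩
    rw [hβ, ← hq (mem_baseSet hqs)] at hbo
    exact (Orientation.map (Fin 2) _).injective hbo
  · refine ⟨-1, ?_⟩
    filter_upwards [h₀, hs] with q hq hqs
    obtain ⟨b, hb, hbo⟩ := key q (mem_baseSet hqs)
    refine ⟨b, hb, Or.inr ⟨rfl, ?_⟩⟩
    rw [hβ, ← hq (mem_baseSet hqs), ← Orientation.map_neg] at hbo
    exact (Orientation.map (Fin 2) _).injective hbo

theorem contDiffOn_chartForm_mvfderiv {f : M → R3} (hf : ContMDiff (𝓡 2) 𝓘(ℝ, R3) ∞ f) (p : M) :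
    ContDiffOn ℝ ∞ (chartForm (mvfderiv (𝓡 2) f) p) (extChartAt (𝓡 2) p).target := by
  have h := contDiffOn_comp_chart_symm p hf.contMDiffOn
  have h' := ((contDiffOn_infty_iff_fderiv_of_isOpen (isOpen_target p)).1 h).2
  refine h'.congr fun y hy => ?_
  exact (hasFDerivAt_comp_chart_symm p hy (hf.mdifferentiableAt (by simp))).fderiv.symm

/-- The 1-form `*dn` is smooth around the centre of each chart. -/
theorem exists_contDiffOn_chartForm_starD {K : Kind}
    {o : ∀ p : M, Orientation ℝ (TangentSpace (𝓡 2) p) (Fin 2)} (ho : IsOrientation o)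
    {g : ∀ p : M, TangentSpace (𝓡 2) p →L[ℝ] TangentSpace (𝓡 2) p →L[ℝ] ℝ} (hg : IsMetric K g)
    {n : M → R3} (hn : ContMDiff (𝓡 2) 𝓘(ℝ, R3) ∞ n) (p : M) :
    ∃ U : Set R2, IsOpen U ∧ extChartAt (𝓡 2) p p ∈ U ∧ U ⊆ (extChartAt (𝓡 2) p).target ∧
      ContDiffOn ℝ ∞ (chartForm (starD g o n) p) U := by
  set β : Module.Basis (Fin 2) ℝ R2 := PiLp.basisFun 2 ℝ (Fin 2) with hβ
  obtain ⟨s, hs⟩ := orientation_basis_map (p := p) ho β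
  have hs' := (tendsto_chart_symm p (mem_extChartAt_source p)).eventually hs
  obtain ⟨U, hUsub, hUo, hpU⟩ := mem_nhds_iff.1 (Filter.inter_mem hs'
    ((isOpen_target p).mem_nhds (mem_extChartAt_target (I := 𝓡 2) p)))
  have hUt : U ⊆ (extChartAt (𝓡 2) p).target := fun y hy => (hUsub hy).2
  refine ⟨U, hUo, hpU, hUt, ?_⟩
  let G : Fin 2 → Fin 2 → R2 → ℝ := fun i j y =>
    g ((extChartAt (𝓡 2) p).symm y) (coordField p (β i) ((extChartAt (𝓡 2) p).symm y))
      (coordField p (β j) ((extChartAt (𝓡 2) p).symm y))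
  have hG : ∀ i j, ContDiffOn ℝ ∞ (G i j) U := fun i j =>
    (contDiffOn_comp_chart_symm p (contMDiffOn_metric_coordField hg p (β i) (β j))).mono hUt
  let D : R2 → ℝ := fun y => G 0 0 y * G 1 1 y - G 0 1 y * G 0 1 y
  have hD : ContDiffOn ℝ ∞ D U := ((hG 0 0).mul (hG 1 1)).sub ((hG 0 1).mul (hG 0 1))
  let N : Fin 2 → R2 → R3 := fun i y => chartForm (mvfderiv (𝓡 2) n) p y (β i)
  have hN : ∀ i, ContDiffOn ℝ ∞ (N i) U := fun i =>
    ((contDiffOn_chartForm_mvfderiv hn p).mono hUt).clm_apply contDiffOn_const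
  have hNapp : ∀ i, ∀ y ∈ U, N i y =
      mvfderiv (𝓡 2) n ((extChartAt (𝓡 2) p).symm y)
        (coordField p (β i) ((extChartAt (𝓡 2) p).symm y)) :=
    fun i y hy => chartForm_apply _ p (hUt hy) (β i)
  -- The Hodge star in the coordinate frame. Its coefficients are built from the Gram matrix G;
  -- `√|D| / D` is smooth because D never vanishes.
  have key : ∀ y ∈ U, D y ≠ 0 ∧
      chartForm (starD g o n) p y (β 0) = s • (√|D y| / D y) • (G 0 1 y • N 0 y - G 0 0 y • N 1 y) ∧
      chartForm (starD g o n) p y (β 1) =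
        s • (√|D y| / D y) • (G 1 1 y • N 0 y - G 0 1 y • N 1 y) := by
    intro y hy
    obtain ⟨b, hb, hor⟩ := (hUsub hy).1
    have hdet := gram_det_ne_zero (hg.symm ((extChartAt (𝓡 2) p).symm y))
      (hg.signature ((extChartAt (𝓡 2) p).symm y)) b
    have hDy : D y ≠ 0 := by simpa only [D, G, ← hb] using hdet
    refine ⟨hDy, ?_⟩
    rw [chartForm_apply _ p (hUt hy), chartForm_apply _ p (hUt hy), hNapp 0 y hy, hNapp 1 y hy]
    change hodge (g ((extChartAt (𝓡 2) p).symm y)) (o ((extChartAt (𝓡 2) p).symm y))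
        (mvfderiv (𝓡 2) n ((extChartAt (𝓡 2) p).symm y))
        (coordField p (β 0) ((extChartAt (𝓡 2) p).symm y)) = _ ∧
      hodge (g ((extChartAt (𝓡 2) p).symm y)) (o ((extChartAt (𝓡 2) p).symm y))
        (mvfderiv (𝓡 2) n ((extChartAt (𝓡 2) p).symm y))
        (coordField p (β 1) ((extChartAt (𝓡 2) p).symm y)) = _
    simp only [D, G, ← hb]
    rcases hor with ⟨rfl, hor⟩ | ⟨rfl, hor⟩
    · have := hodge_apply_basis (g ((extChartAt (𝓡 2) p).symm y)) b hor (hg.symm _ _ _) hdet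
        (mvfderiv (𝓡 2) n ((extChartAt (𝓡 2) p).symm y))
      rw [one_smul, one_smul]
      exact this
    · have := hodge_apply_basis (g ((extChartAt (𝓡 2) p).symm y)) b hor (hg.symm _ _ _) hdet
        (mvfderiv (𝓡 2) n ((extChartAt (𝓡 2) p).symm y))
      rw [hodge_neg, neg_apply, neg_apply, neg_eq_iff_eq_neg, neg_eq_iff_eq_neg] at this
      rw [neg_one_smul, neg_one_smul]
      exact this
  have hκ : ContDiffOn ℝ ∞ (fun y => √|D y| / D y) U := by
    refine ContDiffOn.div (ContDiffOn.sqrt (ContDiffOn.abs hD fun y hy => (key y hy).1)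
      fun y hy => abs_ne_zero.2 (key y hy).1) hD fun y hy => (key y hy).1
  have h0 : ContDiffOn ℝ ∞ (fun y => chartForm (starD g o n) p y (β 0)) U :=
    (((hκ.smul (((hG 0 1).smul (hN 0)).sub ((hG 0 0).smul (hN 1)))).const_smul s)).congr
      fun y hy => (key y hy).2.1
  have h1 : ContDiffOn ℝ ∞ (fun y => chartForm (starD g o n) p y (β 1)) U :=
    (((hκ.smul (((hG 1 1).smul (hN 0)).sub ((hG 0 1).smul (hN 1)))).const_smul s)).congr
      fun y hy => (key y hy).2.2
  rw [contDiffOn_clm_apply]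
  intro v
  refine ((h0.const_smul (β.coord 0 v)).add (h1.const_smul (β.coord 1 v))).congr fun y _ => ?_
  conv_lhs => rw [← basis_repr_eq β v]
  rw [map_add, map_smul, map_smul]

theorem exists_contDiffOn_chartForm_crossStarD {K : Kind}
    {o : ∀ p : M, Orientation ℝ (TangentSpace (𝓡 2) p) (Fin 2)} (ho : IsOrientation o)
    {g : ∀ p : M, TangentSpace (𝓡 2) p →L[ℝ] TangentSpace (𝓡 2) p →L[ℝ] ℝ} (hg : IsMetric K g)
    {n : M → R3} (hn : ContMDiff (𝓡 2) 𝓘(ℝ, R3) ∞ n) (p : M) :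
    ∃ U : Set R2, IsOpen U ∧ extChartAt (𝓡 2) p p ∈ U ∧ U ⊆ (extChartAt (𝓡 2) p).target ∧
      ContDiffOn ℝ ∞ (chartForm (crossStarD K g o n) p) U := by
  obtain ⟨U, hU, hp, hUt, h⟩ := exists_contDiffOn_chartForm_starD ho hg hn p
  refine ⟨U, hU, hp, hUt, ?_⟩
  have hN := (contDiffOn_comp_chart_symm p hn.contMDiffOn).mono hUt
  exact (K.crossL.contDiff.comp_contDiffOn hN).clm_comp h

/-- If `d*dn` is parallel to `n`, then `n × *dn` is closed. -/
theorem extDerivOne_crossStarD_eq_zero {K : Kind}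
    {o : ∀ p : M, Orientation ℝ (TangentSpace (𝓡 2) p) (Fin 2)} (ho : IsOrientation o)
    {g : ∀ p : M, TangentSpace (𝓡 2) p →L[ℝ] TangentSpace (𝓡 2) p →L[ℝ] ℝ} (hg : IsMetric K g)
    {n : M → R3} (hn : ContMDiff (𝓡 2) 𝓘(ℝ, R3) ∞ n)
    (hpar : ∀ p v w, ∃ c : ℝ, extDerivOne (starD g o n) p v w = c • n p) (p : M)
    (v w : TangentSpace (𝓡 2) p) : extDerivOne (crossStarD K g o n) p v w = 0 := by
  obtain ⟨U, hU, hp, hUt, h⟩ := exists_contDiffOn_chartForm_starD ho hg hn p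
  set y := extChartAt (𝓡 2) p p with hy
  have hpt : (extChartAt (𝓡 2) p).symm y = p :=
    (extChartAt (𝓡 2) p).left_inv (mem_extChartAt_source p)
  set S := fderiv ℝ (chartForm (starD g o n) p) y with hSdef
  have hS : HasFDerivAt (chartForm (starD g o n) p) S y :=
    ((h.contDiffAt (hU.mem_nhds hp)).differentiableAt (by simp)).hasFDerivAt
  have hN := hasFDerivAt_comp_chart_symm p (hUt hp) (hn.mdifferentiableAt (by simp))
  have hc : HasFDerivAt (chartForm (crossStarD K g o n) p) _ y :=
    ((K.crossL.hasFDerivAt).comp y hN).clm_comp hS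
  have hderiv : ∀ v w : R2, fderiv ℝ (chartForm (crossStarD K g o n) p) y v w =
      K.cross (n p) (S v w) + K.cross (chartForm (mvfderiv (𝓡 2) n) p y v)
        (chartForm (starD g o n) p y w) := by
    intro v w
    have hnp : n ((extChartAt (𝓡 2) p).symm y) = n p := by rw [hpt]
    rw [hc.fderiv, ← hnp]
    rfl
  obtain ⟨b, hb⟩ := exists_isOrthonormalFrame K (g ((extChartAt (𝓡 2) p).symm y)) (hg.symm _)
    (hg.signature _) (o ((extChartAt (𝓡 2) p).symm y))
  have hmain : ∀ v w : R2, fderiv ℝ (chartForm (crossStarD K g o n) p) y v w -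
      fderiv ℝ (chartForm (crossStarD K g o n) p) y w v = 0 := by
    intro v w
    obtain ⟨c, hpc⟩ := hpar p v w
    have hpc' : S v w - S w v = c • n p := hpc
    -- By Leibniz the derivative has one term with n × D(*dn) and one with dn × *dn. This symmetry
    -- cancels the second after antisymmetrisation; the first becomes n × (c n) = 0.
    have hanti : K.cross (chartForm (mvfderiv (𝓡 2) n) p y v) (chartForm (starD g o n) p y w) =
        K.cross (chartForm (mvfderiv (𝓡 2) n) p y w) (chartForm (starD g o n) p y v) :=
      hb.cross_hodge_antisymm (mvfderiv (𝓡 2) n ((extChartAt (𝓡 2) p).symm y))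
        (mfderiv 𝓘(ℝ, R2) (𝓡 2) (extChartAt (𝓡 2) p).symm y v)
        (mfderiv 𝓘(ℝ, R2) (𝓡 2) (extChartAt (𝓡 2) p).symm y w)
    rw [hderiv, hderiv, hanti, add_sub_add_right_eq_sub, ← map_sub, hpc', map_smul, K.cross_self,
      smul_zero]
  exact hmain v w

/-- A primitive of a smooth 1-form is smooth. -/
theorem IsPrimitive.contMDiff {θ : ∀ q : M, TangentSpace (𝓡 2) q →L[ℝ] R3} {y : M → R3}
    (hy : IsPrimitive θ y) (hθ : ∀ p, ∃ U : Set R2, IsOpen U ∧ extChartAt (𝓡 2) p p ∈ U ∧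
      U ⊆ (extChartAt (𝓡 2) p).target ∧ ContDiffOn ℝ ∞ (chartForm θ p) U) :
    ContMDiff (𝓡 2) 𝓘(ℝ, R3) ∞ y := by
  intro p
  obtain ⟨U, hU, hp, hUt, h⟩ := hθ p
  have hd : ∀ z ∈ U, HasFDerivAt (y ∘ (extChartAt (𝓡 2) p).symm) (chartForm θ p z) z := by
    intro z hz
    have := hasFDerivAt_comp_chart_symm p (hUt hz) (hy.1 _)
    rwa [show mvfderiv (𝓡 2) y = θ from funext hy.2] at this
  have hsm : ContDiffOn ℝ ∞ (y ∘ (extChartAt (𝓡 2) p).symm) U := by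
    rw [contDiffOn_infty_iff_fderiv_of_isOpen hU]
    exact ⟨fun z hz => (hd z hz).differentiableAt.differentiableWithinAt,
      h.congr fun z hz => (hd z hz).fderiv⟩
  have h1 : ContMDiffAt 𝓘(ℝ, R2) 𝓘(ℝ, R3) ∞ (y ∘ (extChartAt (𝓡 2) p).symm)
      (extChartAt (𝓡 2) p p) := (hsm.contDiffAt (hU.mem_nhds hp)).contMDiffAt
  have h2 := h1.comp p (contMDiffAt_extChartAt (I := 𝓡 2) (x := p))
  refine h2.congr_of_eventuallyEq ?_
  filter_upwards [(isOpen_extChartAt_source (I := 𝓡 2) p).mem_nhds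
    (mem_extChartAt_source p)] with z hz
  exact congrArg y ((extChartAt (𝓡 2) p).left_inv hz).symm

end Smoothness

/-! ### From constant mean curvature to the formula -/

section Surfaces

variable {M : Type*} [TopologicalSpace M] [ChartedSpace R2 M]

theorem firstForm_apply (K : Kind) (x : M → R3) (p : M) (v w : TangentSpace (𝓡 2) p) :
    firstForm K x p v w = K.form (mvfderiv (𝓡 2) x p v) (mvfderiv (𝓡 2) x p w) := rfl

theorem secondForm_apply (K : Kind) (x n : M → R3) (p : M) (v w : TangentSpace (𝓡 2) p) :
    secondForm K x n p v w = -K.form (mvfderiv (𝓡 2) x p v) (mvfderiv (𝓡 2) n p w) := rfl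

theorem firstForm_symm (K : Kind) (x : M → R3) (p : M) (v w : TangentSpace (𝓡 2) p) :
    firstForm K x p v w = firstForm K x p w v := K.form_comm _ _

variable [IsManifold (𝓡 2) ∞ M]

theorem mvfderiv_const_smul {x : M → R3} {p : M} (hx : MDifferentiableAt (𝓡 2) 𝓘(ℝ, R3) x p)
    (a : ℝ) : mvfderiv (𝓡 2) (a • x) p = a • mvfderiv (𝓡 2) x p := by
  ext1 w
  exact DFunLike.congr_fun (hx.hasMFDerivAt.const_smul a).mfderiv w

/-- The differential of a map of constant length is orthogonal to the map. -/
theorem form_mvfderiv_eq_zero {K : Kind} {n : M → R3} (hn : ContMDiff (𝓡 2) 𝓘(ℝ, R3) ∞ n) {c : ℝ}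
    (hc : ∀ p, K.form (n p) (n p) = c) (p : M) (v : TangentSpace (𝓡 2) p) :
    K.form (n p) (mvfderiv (𝓡 2) n p v) = 0 := by
  set y := extChartAt (𝓡 2) p p with hy
  have hpt : (extChartAt (𝓡 2) p).symm y = p :=
    (extChartAt (𝓡 2) p).left_inv (mem_extChartAt_source p)
  have hN := hasFDerivAt_comp_chart_symm p (mem_extChartAt_target (I := 𝓡 2) p)
    (hn.mdifferentiableAt (by simp))
  have hB := K.form.hasFDerivAt_of_bilinear hN hN
  have hconst : (fun z => K.form ((n ∘ (extChartAt (𝓡 2) p).symm) z)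
      ((n ∘ (extChartAt (𝓡 2) p).symm) z)) = fun _ => c := funext fun z => hc _
  rw [hconst] at hB
  have h0 := hB.unique (hasFDerivAt_const c y)
  have h1 := DFunLike.congr_fun h0 (mfderiv (𝓡 2) 𝓘(ℝ, R2) (extChartAt (𝓡 2) p) p v)
  have h2 := chartForm_comp_mfderiv_chart (mvfderiv (𝓡 2) n) p (mem_extChartAt_source p) v
  have h3 : K.form (n ((extChartAt (𝓡 2) p).symm y)) (chartForm (mvfderiv (𝓡 2) n) p y
      (mfderiv (𝓡 2) 𝓘(ℝ, R2) (extChartAt (𝓡 2) p) p v)) +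
    K.form (chartForm (mvfderiv (𝓡 2) n) p y
      (mfderiv (𝓡 2) 𝓘(ℝ, R2) (extChartAt (𝓡 2) p) p v)) (n ((extChartAt (𝓡 2) p).symm y)) = 0 := h1
  rw [K.form_comm _ (n _), hpt] at h3
  have h4 : K.form (n p) (mvfderiv (𝓡 2) n p v) + K.form (n p) (mvfderiv (𝓡 2) n p v) = 0 := by
    rw [← h2]; exact h3
  linarith

/-- Symmetry of the second fundamental form. -/
theorem form_mvfderiv_symm {K : Kind} {x n : M → R3} (hx : ContMDiff (𝓡 2) 𝓘(ℝ, R3) ∞ x)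
    (hn : ContMDiff (𝓡 2) 𝓘(ℝ, R3) ∞ n)
    (h : ∀ p v, K.form (n p) (mvfderiv (𝓡 2) x p v) = 0) (p : M) (v w : TangentSpace (𝓡 2) p) :
    K.form (mvfderiv (𝓡 2) x p v) (mvfderiv (𝓡 2) n p w) =
      K.form (mvfderiv (𝓡 2) x p w) (mvfderiv (𝓡 2) n p v) := by
  set y := extChartAt (𝓡 2) p p with hy
  have hyt := mem_extChartAt_target (I := 𝓡 2) p
  have hpt : (extChartAt (𝓡 2) p).symm y = p :=
    (extChartAt (𝓡 2) p).left_inv (mem_extChartAt_source p)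
  have hN := hasFDerivAt_comp_chart_symm p hyt (hn.mdifferentiableAt (by simp))
  set X := x ∘ (extChartAt (𝓡 2) p).symm with hX
  have hXs : ContDiffAt ℝ ∞ X y := (contDiffOn_comp_chart_symm p hx.contMDiffOn).contDiffAt
    ((isOpen_target p).mem_nhds hyt)
  have hX2 : HasFDerivAt (fderiv ℝ X) (fderiv ℝ (fderiv ℝ X) y) y :=
    ((hXs.fderiv_right (m := 1) (by norm_cast)).differentiableAt (by simp)).hasFDerivAt
  have hsymm : IsSymmSndFDerivAt ℝ X y := hXs.isSymmSndFDerivAt (by simp; norm_cast)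
  have hXform : ∀ z ∈ (extChartAt (𝓡 2) p).target,
      fderiv ℝ X z = chartForm (mvfderiv (𝓡 2) x) p z := fun z hz =>
    (hasFDerivAt_comp_chart_symm p hz (hx.mdifferentiableAt (by simp))).fderiv
  -- Differentiating ⟨n, dx⟩ = 0 expresses ⟨dn, dx⟩ as -⟨n, D²x⟩, and D²x is symmetric.
  have key : ∀ v w : R2, K.form (n ((extChartAt (𝓡 2) p).symm y)) (fderiv ℝ (fderiv ℝ X) y w v) +
      K.form (chartForm (mvfderiv (𝓡 2) n) p y w) (fderiv ℝ X y v) = 0 := by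
    intro v w
    have hXv : HasFDerivAt (fun z => fderiv ℝ X z v)
        ((ContinuousLinearMap.apply ℝ R3 v) ∘L fderiv ℝ (fderiv ℝ X) y) y :=
      (ContinuousLinearMap.apply ℝ R3 v).hasFDerivAt.comp y hX2
    have hB := K.form.hasFDerivAt_of_bilinear hN hXv
    have hev : (fun z => K.form ((n ∘ (extChartAt (𝓡 2) p).symm) z) (fderiv ℝ X z v)) =ᶠ[𝓝 y]
        fun _ => (0 : ℝ) := by
      filter_upwards [(isOpen_target p).mem_nhds hyt] with z hz
      rw [hXform z hz]
      exact h _ _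
    have h0 := hB.unique ((hasFDerivAt_const (0 : ℝ) y).congr_of_eventuallyEq hev)
    exact DFunLike.congr_fun h0 w
  have main : ∀ v w : R2,
      K.form (chartForm (mvfderiv (𝓡 2) x) p y v) (chartForm (mvfderiv (𝓡 2) n) p y w) =
      K.form (chartForm (mvfderiv (𝓡 2) x) p y w) (chartForm (mvfderiv (𝓡 2) n) p y v) := by
    intro v w
    have h1 := key v w
    have h2 := key w v
    rw [hsymm w v] at h1
    rw [hXform y hyt, K.form_comm (chartForm _ p y _)] at h1 h2
    linarith
  have hv := fun v => chartForm_comp_mfderiv_chart (mvfderiv (𝓡 2) n) p (mem_extChartAt_source p) v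
  have hv' := fun v => chartForm_comp_mfderiv_chart (mvfderiv (𝓡 2) x) p (mem_extChartAt_source p) v
  have := main (mfderiv (𝓡 2) 𝓘(ℝ, R2) (extChartAt (𝓡 2) p) p v)
    (mfderiv (𝓡 2) 𝓘(ℝ, R2) (extChartAt (𝓡 2) p) p w)
  have e1 := hv v
  have e2 := hv w
  have e3 := hv' v
  have e4 := hv' w
  calc K.form (mvfderiv (𝓡 2) x p v) (mvfderiv (𝓡 2) n p w) = _ := by rw [← e3, ← e2]
    _ = _ := this
    _ = _ := by rw [← e4, ← e1]

/-- For an immersion of constant mean curvature, `dn + n × *dn = -2H dx`. -/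
theorem IsCMC.mvfderiv_add_crossStarD {K : Kind}
    {o : ∀ p : M, Orientation ℝ (TangentSpace (𝓡 2) p) (Fin 2)} {H : ℝ} {x n : M → R3}
    (h : IsCMC K o H x n) (p : M) :
    mvfderiv (𝓡 2) n p + crossStarD K (firstForm K x) o n p =
      (-(2 * H)) • mvfderiv (𝓡 2) x p := by
  have frame : ∀ q, ∃ b, IsOrthonormalFrame K (firstForm K x q) (o q) b ∧
      n q = K.gaussSign • K.cross (mvfderiv (𝓡 2) x q (b 0)) (mvfderiv (𝓡 2) x q (b 1)) := by
    intro q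
    obtain ⟨b, hb⟩ := exists_isOrthonormalFrame K (firstForm K x q) (firstForm_symm K x q)
      (h.immersion.signature q) (o q)
    exact ⟨b, hb, h.gaussMap.eq_cross q b hb.orientation hb.apply_zero_zero hb.apply_zero_one
      hb.apply_one_one⟩
  have hnormal : ∀ q v, K.form (n q) (mvfderiv (𝓡 2) x q v) = 0 := by
    intro q v
    obtain ⟨b, hb, hnb⟩ := frame q
    have hc := K.cross_normal hb.apply_zero_zero hb.apply_zero_one hb.apply_one_one hnb
    have h0 : K.form (n q) (mvfderiv (𝓡 2) x q (b 0)) = 0 := hc.2.2.1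
    have h1 : K.form (n q) (mvfderiv (𝓡 2) x q (b 1)) = 0 := hc.2.2.2.1
    rw [← basis_repr_eq b v, map_add, map_smul, map_smul, map_add, map_smul, map_smul, h0, h1]
    simp
  have hunit : ∀ q, K.form (n q) (n q) = K.normalSign := by
    intro q
    obtain ⟨b, hb, hnb⟩ := frame q
    exact (K.cross_normal hb.apply_zero_zero hb.apply_zero_one hb.apply_one_one hnb).2.2.2.2
  obtain ⟨b, hb, hnb⟩ := frame p
  have hH := h.meanCurvature_eq p
  rw [meanCurvature, trace_inverse_comp _ _ b hb.apply_zero_one hb.apply_one_zero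
    (by rw [hb.apply_zero_zero]; exact one_ne_zero)
    (by rw [hb.apply_one_one]; exact K.frameSign_ne_zero), hb.apply_zero_zero, hb.apply_one_one,
    secondForm_apply, secondForm_apply,
    ← eq_inv_of_mul_eq_one_left K.frameSign_mul_self] at hH
  refine hb.add_cross_hodge_eq (fun _ _ => rfl) hnb
    (form_mvfderiv_eq_zero h.gaussMap.contMDiff hunit p)
    (form_mvfderiv_symm h.immersion.contMDiff h.gaussMap.contMDiff hnormal p) ?_
  linarith

/-- The primitive is -2H x - n, by dn + n × *dn = -2H dx. -/
theorem IsCMC.exists_isPrimitive {K : Kind}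
    {o : ∀ p : M, Orientation ℝ (TangentSpace (𝓡 2) p) (Fin 2)} {H : ℝ} (hH : H ≠ 0)
    {x n : M → R3} (h : IsCMC K o H x n) :
    ∃ y : M → R3, IsPrimitive (crossStarD K (firstForm K x) o n) y ∧
      ∀ p, x p = -(1 / (2 * H)) • (n p + y p) := by
  have hxd : ∀ p, MDifferentiableAt (𝓡 2) 𝓘(ℝ, R3) x p := fun p =>
    h.immersion.contMDiff.mdifferentiableAt (by simp)
  have hnd : ∀ p, MDifferentiableAt (𝓡 2) 𝓘(ℝ, R3) n p := fun p =>
    h.gaussMap.contMDiff.mdifferentiableAt (by simp)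
  refine ⟨(-(2 * H)) • x - n, ⟨fun p => ((hxd p).const_smul _).sub (hnd p), fun p => ?_⟩,
    fun p => ?_⟩
  · rw [mvfderiv_sub ((hxd p).const_smul _) (hnd p), mvfderiv_const_smul (hxd p),
      ← h.mvfderiv_add_crossStarD p, add_sub_cancel_left]
  · simp only [Pi.sub_apply, Pi.smul_apply]
    rw [add_sub_cancel, smul_smul]
    have : -(1 / (2 * H)) * -(2 * H) = 1 := by field_simp
    rw [this, one_smul]

end Surfaces

/-! ### Rescaling and swapping frames -/

section Plane

variable {T : Type*} [AddCommGroup T] [Module ℝ T]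

theorem exists_basis_smul (e : Module.Basis (Fin 2) ℝ T) {k : ℝ} (hk : k ≠ 0) :
    ∃ f : Module.Basis (Fin 2) ℝ T, f 0 = k • e 0 ∧ f 1 = k • e 1 ∧
      f.orientation = e.orientation := by
  have hu : ∀ i : Fin 2, IsUnit ((fun _ => k) i) := fun _ => isUnit_iff_ne_zero.2 hk
  refine ⟨e.isUnitSMul hu, by simp [Module.Basis.isUnitSMul_apply],
    by simp [Module.Basis.isUnitSMul_apply], Eq.symm ?_⟩
  rw [Module.Basis.orientation_eq_iff_det_pos, det_basis_apply]
  simp [Module.Basis.isUnitSMul_apply, hk]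

/-- For a negative conformal factor the spacelike and timelike vectors of a frame exchange roles,
which reverses the orientation. -/
theorem exists_basis_smul_swap (e : Module.Basis (Fin 2) ℝ T) {k : ℝ} (hk : k ≠ 0) :
    ∃ f : Module.Basis (Fin 2) ℝ T, f 0 = k • e 1 ∧ f 1 = k • e 0 ∧
      f.orientation = -e.orientation := by
  have hu : ∀ i : Fin 2, IsUnit ((fun _ => k) i) := fun _ => isUnit_iff_ne_zero.2 hk
  set f := (e.reindex (Equiv.swap 0 1)).isUnitSMul hu with hf
  have f0 : f 0 = k • e 1 := by simp [hf, Module.Basis.isUnitSMul_apply]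
  have f1 : f 1 = k • e 0 := by simp [hf, Module.Basis.isUnitSMul_apply]
  refine ⟨f, f0, f1, ?_⟩
  rcases e.orientation_eq_or_eq_neg f.orientation with h | h
  · have := (Module.Basis.orientation_eq_iff_det_pos _ _).1 h.symm
    rw [det_basis_apply, f0, f1] at this
    simp at this
    nlinarith [mul_self_nonneg k]
  · exact h

end Plane

/-! ### The conformal factor and the converse -/

section Surfaces

variable {M : Type*} [TopologicalSpace M] [ChartedSpace R2 M] [IsManifold (𝓡 2) ∞ M]

theorem chartForm_apply_chart (θ : ∀ q : M, TangentSpace (𝓡 2) q →L[ℝ] R3) (p : M) {q : M}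
    (hq : q ∈ (extChartAt (𝓡 2) p).source) (v : R2) :
    chartForm θ p (extChartAt (𝓡 2) p q) v = θ q (coordField p v q) := by
  have h := chartForm_apply θ p ((extChartAt (𝓡 2) p).map_source hq) v
  rw [(extChartAt (𝓡 2) p).left_inv hq] at h
  exact h

/-- The conformal factor relating a continuous 1-form to a Lorentzian metric has locally constant
sign. -/
theorem eventually_mul_conformal_factor_pos {g : ∀ p : M, TangentSpace (𝓡 2) p →L[ℝ]
      TangentSpace (𝓡 2) p →L[ℝ] ℝ} (hg : IsMetric .timelike g)
    {η : ∀ p : M, TangentSpace (𝓡 2) p →L[ℝ] R3} {c : M → ℝ}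
    (hηc : ∀ p, ContinuousAt (chartForm η p) (extChartAt (𝓡 2) p p))
    (hη : ∀ p v w, Kind.timelike.form (η p v) (η p w) = c p * g p v w) {p : M} (hp : c p ≠ 0) :
    ∀ᶠ q in 𝓝 p, 0 < c p * c q := by
  -- Continuity of c is not assumed. A spacelike v is extended to a field V with constant
  -- coordinates; both g(V, V) and ⟨η V, η V⟩ = c g(V, V) are continuous, and their signs near p
  -- determine that of c.
  obtain ⟨⟨v, hv⟩, -⟩ := hg.signature p
  have hps := mem_extChartAt_source (I := 𝓡 2) p
  have hs := (isOpen_extChartAt_source (I := 𝓡 2) p).mem_nhds hps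
  set v' : R2 :=
    (trivializationAt R2 (TangentSpace (𝓡 2) : M → Type _) p).continuousLinearMapAt ℝ p v
  have hv' : coordField p v' p = v :=
    Bundle.Trivialization.symmL_continuousLinearMapAt _ (mem_baseSet hps) v
  have hA : ContinuousAt (fun q => g q (coordField p v' q) (coordField p v' q)) p :=
    ((contMDiffOn_metric_coordField hg p v' v').contMDiffAt hs).continuousAt
  have hV : ContinuousAt (fun q => chartForm η p (extChartAt (𝓡 2) p q) v') p := by
    have h1 : ContinuousAt (fun q => chartForm η p (extChartAt (𝓡 2) p q)) p :=
      ContinuousAt.comp (hηc p) (continuousAt_extChartAt p)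
    exact h1.clm_apply continuousAt_const
  have hB : ContinuousAt (fun q => c p * Kind.timelike.form
      (chartForm η p (extChartAt (𝓡 2) p q) v') (chartForm η p (extChartAt (𝓡 2) p q) v')) p :=
    continuousAt_const.mul
      (((Kind.timelike.form).continuous.continuousAt.comp hV).clm_apply hV)
  have hA0 : 0 < g p (coordField p v' p) (coordField p v' p) := by rw [hv']; exact hv
  have hB0 : 0 < c p * Kind.timelike.form
      (chartForm η p (extChartAt (𝓡 2) p p) v') (chartForm η p (extChartAt (𝓡 2) p p) v') := by
    rw [chartForm_apply_chart η p hps, hη, ← mul_assoc]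
    exact mul_pos (mul_self_pos.2 hp) hA0
  filter_upwards [hs, hA.eventually (lt_mem_nhds hA0), hB.eventually (lt_mem_nhds hB0)]
    with q hq hAq hBq
  rw [chartForm_apply_chart η p hq, hη, ← mul_assoc] at hBq
  exact (pos_iff_pos_of_mul_pos hBq).2 hAq

theorem conformal_factor_pos_or_neg [PreconnectedSpace M] {g : ∀ p : M, TangentSpace (𝓡 2) p →L[ℝ]
      TangentSpace (𝓡 2) p →L[ℝ] ℝ} (hg : IsMetric .timelike g)
    {η : ∀ p : M, TangentSpace (𝓡 2) p →L[ℝ] R3} {c : M → ℝ}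
    (hηc : ∀ p, ContinuousAt (chartForm η p) (extChartAt (𝓡 2) p p))
    (hη : ∀ p v w, Kind.timelike.form (η p v) (η p w) = c p * g p v w) (hc : ∀ p, c p ≠ 0) :
    (∀ p, 0 < c p) ∨ ∀ p, c p < 0 := by
  have hloc := fun p => eventually_mul_conformal_factor_pos hg hηc hη (hc p)
  have hclopen : IsClopen {p | 0 < c p} := by
    refine ⟨⟨isOpen_iff_mem_nhds.2 fun p hp => ?_⟩, isOpen_iff_mem_nhds.2 fun p hp => ?_⟩
    · have hp' : c p < 0 := lt_of_le_of_ne (not_lt.1 hp) (hc p)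
      filter_upwards [hloc p] with q hq
      exact not_lt.2 (neg_of_mul_pos_right hq hp'.le).le
    · filter_upwards [hloc p] with q hq
      exact (pos_iff_pos_of_mul_pos hq).1 hp
  rcases isClopen_iff.1 hclopen with h | h
  · exact Or.inr fun p => lt_of_le_of_ne
      (not_lt.1 fun hp => Set.eq_empty_iff_forall_notMem.1 h p hp) (hc p)
  · exact Or.inl (Set.eq_univ_iff_forall.1 h)

section Immersion

variable {K : Kind} {o : ∀ p : M, Orientation ℝ (TangentSpace (𝓡 2) p) (Fin 2)}
  {g : ∀ p : M, TangentSpace (𝓡 2) p →L[ℝ] TangentSpace (𝓡 2) p →L[ℝ] ℝ}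
  {n x : M → R3} {η : ∀ p : M, TangentSpace (𝓡 2) p →L[ℝ] R3} {c : M → ℝ} {H : ℝ}

theorem firstForm_eq_of_conformal (hdx : ∀ p, mvfderiv (𝓡 2) x p = (-(1 / (2 * H))) • η p)
    (hη : ∀ p, IsConformalAt K (g p) (o p) (n p) (mvfderiv (𝓡 2) n p) (η p) (c p))
    (p : M) (v w : TangentSpace (𝓡 2) p) :
    firstForm K x p v w = (1 / (2 * H)) ^ 2 * c p * g p v w := by
  rw [firstForm_apply, hdx, smul_apply, smul_apply, map_smul, map_smul, smul_apply,
    (hη p).form_eq, smul_eq_mul, smul_eq_mul]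
  ring

/-- The induced metric is c/(4H²) times g, and II has g-trace c/(2H); the quotient is 2H, whatever
the sign of c. -/
theorem meanCurvature_eq_of_conformal (hH : H ≠ 0) (hg : IsMetric K g)
    (hdx : ∀ p, mvfderiv (𝓡 2) x p = (-(1 / (2 * H))) • η p)
    (hη : ∀ p, IsConformalAt K (g p) (o p) (n p) (mvfderiv (𝓡 2) n p) (η p) (c p))
    (hc : ∀ p, c p ≠ 0) (p : M) : meanCurvature K x n p = H := by
  obtain ⟨b, hb⟩ := exists_isOrthonormalFrame K (g p) (hg.symm p) (hg.signature p) (o p)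
  have hI := firstForm_eq_of_conformal hdx hη p
  have hcp := hc p
  have hε := K.frameSign_ne_zero
  have htr := (hη p).trace_eq b hb
  have hεi : K.frameSign⁻¹ = K.frameSign :=
    (eq_inv_of_mul_eq_one_left K.frameSign_mul_self).symm
  have hr : (1 / (2 * H)) ≠ 0 := one_div_ne_zero (mul_ne_zero two_ne_zero hH)
  rw [meanCurvature, trace_inverse_comp _ _ b (by rw [hI, hb.apply_zero_one, mul_zero])
    (by rw [hI, hb.apply_one_zero, mul_zero])
    (by rw [hI, hb.apply_zero_zero]; positivity)
    (by rw [hI, hb.apply_one_one]; positivity),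
    hI, hI, hb.apply_zero_zero, hb.apply_one_one, secondForm_apply, secondForm_apply, hdx,
    smul_apply, smul_apply, map_smul, map_smul, smul_apply, smul_apply, smul_eq_mul, smul_eq_mul,
    mul_inv _ K.frameSign, hεi]
  calc _ = (1 / 2) * (((1 / (2 * H)) ^ 2 * c p)⁻¹ * (1 / (2 * H)) *
        (K.form (η p (b 0)) (mvfderiv (𝓡 2) n p (b 0)) +
          K.frameSign * K.form (η p (b 1)) (mvfderiv (𝓡 2) n p (b 1)))) := by ring
    _ = H := by rw [htr]; field_simp

theorem isCMC_of_conformal_pos (hH : H ≠ 0) (hg : IsMetric K g)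
    (hx : ContMDiff (𝓡 2) 𝓘(ℝ, R3) ∞ x) (hn : ContMDiff (𝓡 2) 𝓘(ℝ, R3) ∞ n)
    (hdx : ∀ p, mvfderiv (𝓡 2) x p = (-(1 / (2 * H))) • η p)
    (hη : ∀ p, IsConformalAt K (g p) (o p) (n p) (mvfderiv (𝓡 2) n p) (η p) (c p))
    (hinj : ∀ p, Function.Injective (η p)) (hc : ∀ p, 0 < c p) : IsCMC K o H x n := by
  have hr : (1 / (2 * H)) ≠ 0 := one_div_ne_zero (mul_ne_zero two_ne_zero hH)
  have hI := firstForm_eq_of_conformal hdx hη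
  have hpos : ∀ p, 0 < (1 / (2 * H)) ^ 2 * c p := fun p => mul_pos (by positivity) (hc p)
  refine ⟨⟨hx, fun p => ?_, fun p => ?_⟩, ⟨hn, fun p e heo h00 h01 h11 => ?_⟩,
    meanCurvature_eq_of_conformal hH hg hdx hη fun p => (hc p).ne'⟩
  · rw [hdx p]
    exact (smul_right_injective R3 (neg_ne_zero.2 hr)).comp (hinj p)
  · have hs := hg.signature p
    cases K with
    | euclidean => exact fun v hv => by rw [hI]; exact mul_pos (hpos p) (hs v hv)
    | spacelike => exact fun v hv => by rw [hI]; exact mul_pos (hpos p) (hs v hv)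
    | timelike =>
      obtain ⟨⟨v, hv⟩, w, hw⟩ := hs
      exact ⟨⟨v, by rw [hI]; exact mul_pos (hpos p) hv⟩,
        w, by rw [hI]; exact mul_neg_of_pos_of_neg (hpos p) hw⟩
  -- Scaling by k turns a frame orthonormal for the induced metric into one orthonormal for g, of
  -- the same orientation, where `cross_eq` applies.
  · set k := √((1 / (2 * H)) ^ 2 * c p) with hk
    have hkk : k * k = (1 / (2 * H)) ^ 2 * c p := Real.mul_self_sqrt (hpos p).le
    have hk0 : k ≠ 0 := (Real.sqrt_pos.2 (hpos p)).ne'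
    obtain ⟨f, f0, f1, hfo⟩ := exists_basis_smul e hk0
    have hgf : ∀ u v, g p (k • u) (k • v) = firstForm K x p u v := by
      intro u v
      rw [hI, ← hkk, map_smul, map_smul, smul_apply, smul_eq_mul, smul_eq_mul, mul_assoc]
    have hf : IsOrthonormalFrame K (g p) (o p) f :=
      ⟨hfo.trans heo, by rw [f0, hgf, h00], by rw [f0, f1, hgf, h01],
        by rw [f0, f1, hgf, firstForm_symm, h01], by rw [f1, hgf, h11]⟩
    have hcr := (hη p).cross_eq f hf
    rw [f0, f1, map_smul, map_smul, K.cross_smul_left, map_smul, smul_smul, hkk] at hcr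
    rw [hdx p, smul_apply, smul_apply, K.cross_smul_left, map_smul, smul_smul, smul_smul,
      K.gaussSign_eq]
    have hδ := K.ambientSign_mul_self
    have hcp := (hc p).ne'
    calc n p = ((c p)⁻¹ * K.ambientSign) • (K.ambientSign * c p) • n p := by
          rw [smul_smul]
          have : (c p)⁻¹ * K.ambientSign * (K.ambientSign * c p) = 1 := by
            calc _ = (c p)⁻¹ * c p * (K.ambientSign * K.ambientSign) := by ring
              _ = 1 := by rw [hδ, inv_mul_cancel₀ hcp, one_mul]
          rw [this, one_smul]
      _ = _ := by
          rw [← hcr, smul_smul]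
          congr 1
          field_simp

theorem isCMC_neg_of_conformal_neg (hH : H ≠ 0) (hg : IsMetric .timelike g)
    (hx : ContMDiff (𝓡 2) 𝓘(ℝ, R3) ∞ x) (hn : ContMDiff (𝓡 2) 𝓘(ℝ, R3) ∞ n)
    (hdx : ∀ p, mvfderiv (𝓡 2) x p = (-(1 / (2 * H))) • η p)
    (hη : ∀ p, IsConformalAt .timelike (g p) (o p) (n p) (mvfderiv (𝓡 2) n p) (η p) (c p))
    (hinj : ∀ p, Function.Injective (η p)) (hc : ∀ p, c p < 0) :
    IsCMC .timelike (fun p => -o p) H x n := by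
  have hr : (1 / (2 * H)) ≠ 0 := one_div_ne_zero (mul_ne_zero two_ne_zero hH)
  have hI := firstForm_eq_of_conformal hdx hη
  have hneg : ∀ p, (1 / (2 * H)) ^ 2 * c p < 0 := fun p =>
    mul_neg_of_pos_of_neg (by positivity) (hc p)
  refine ⟨⟨hx, fun p => ?_, fun p => ?_⟩, ⟨hn, fun p e heo h00 h01 h11 => ?_⟩,
    meanCurvature_eq_of_conformal hH hg hdx hη fun p => (hc p).ne⟩
  · rw [hdx p]
    exact (smul_right_injective R3 (neg_ne_zero.2 hr)).comp (hinj p)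
  · obtain ⟨⟨v, hv⟩, w, hw⟩ := hg.signature p
    exact ⟨⟨w, by rw [hI]; exact mul_pos_of_neg_of_neg (hneg p) hw⟩,
        v, by rw [hI]; exact mul_neg_of_neg_of_pos (hneg p) hv⟩
  -- Now k² g is minus the induced metric, so the scaled frame must also be swapped to be
  -- g-orthonormal. The swap accounts both for the opposite orientation and for the sign of c in the
  -- vector product.
  · set k := √(-((1 / (2 * H)) ^ 2 * c p)) with hk
    have hkk : k * k = -((1 / (2 * H)) ^ 2 * c p) := Real.mul_self_sqrt (neg_pos.2 (hneg p)).le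
    have hk0 : k ≠ 0 := (Real.sqrt_pos.2 (neg_pos.2 (hneg p))).ne'
    obtain ⟨f, f0, f1, hfo⟩ := exists_basis_smul_swap e hk0
    have hgf : ∀ u v, g p (k • u) (k • v) = -firstForm .timelike x p u v := by
      intro u v
      rw [hI, map_smul, map_smul, smul_apply, smul_eq_mul, smul_eq_mul, ← mul_assoc, hkk]
      ring
    have hf : IsOrthonormalFrame .timelike (g p) (o p) f :=
      ⟨by rw [hfo, heo]; exact neg_neg (o p), by rw [f0, hgf, h11]; simp [Kind.frameSign],
        by rw [f0, f1, hgf, firstForm_symm, h01, neg_zero], by rw [f0, f1, hgf, h01, neg_zero],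
        by rw [f1, hgf, h00]; simp [Kind.frameSign]⟩
    have hcr := (hη p).cross_eq f hf
    rw [f0, f1, map_smul, map_smul, Kind.cross_smul_left, map_smul, smul_smul, hkk,
      Kind.cross_anticomm, smul_neg, neg_smul, neg_neg] at hcr
    rw [hdx p, smul_apply, smul_apply, Kind.cross_smul_left, map_smul, smul_smul, smul_smul,
      Kind.gaussSign_eq]
    have hcp := (hc p).ne
    simp only [Kind.ambientSign] at hcr ⊢
    calc n p = (-(c p)⁻¹) • (-1 * c p) • n p := by
          rw [smul_smul]
          have : -(c p)⁻¹ * (-1 * c p) = 1 := by field_simp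
          rw [this, one_smul]
      _ = _ := by
          rw [← hcr, smul_smul]
          congr 1
          field_simp

end Immersion

end Surfaces

end Kenmotsu

/-! ### The representation theorem -/

open Kenmotsu in
theorem corollary2p3 (K : Kind) (M : Type*) [TopologicalSpace M] [T2Space M]
    [SecondCountableTopology M] [ChartedSpace R2 M] [IsManifold (𝓡 2) ∞ M]
    (o : ∀ p : M, Orientation ℝ (TangentSpace (𝓡 2) p) (Fin 2)) (ho : IsOrientation o)
    (H : ℝ) (hH : H ≠ 0) :
    (ConnectedSpace M → ∀ x n : M → R3, IsCMC K o H x n →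
      ∃ y : M → R3, IsPrimitive (crossStarD K (firstForm K x) o n) y ∧
        ∀ p, x p = -(1 / (2 * H)) • (n p + y p)) ∧
    (SimplyConnectedSpace M →
      ∀ g : (∀ p : M, TangentSpace (𝓡 2) p →L[ℝ] TangentSpace (𝓡 2) p →L[ℝ] ℝ),
      IsMetric K g →
      ∀ n : M → R3, ContMDiff (𝓡 2) 𝓘(ℝ, R3) ∞ n →
      (∀ p, K.form (n p) (n p) = K.normalSign) →
      (∀ p v w, ∃ c : ℝ, extDerivOne (starD g o n) p v w = c • n p) →
      K.Nonvanishing (fun p => mvfderiv (𝓡 2) n p + crossStarD K g o n p) →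
      (∃ y : M → R3, IsPrimitive (crossStarD K g o n) y) ∧
      ∀ y : M → R3, IsPrimitive (crossStarD K g o n) y →
        IsCMC K o H (fun p => -(1 / (2 * H)) • (n p + y p)) n ∨
        (K = Kind.timelike ∧
          IsCMC K (fun p => -o p) H (fun p => -(1 / (2 * H)) • (n p + y p)) n)) := by
  refine ⟨fun _ x n h => h.exists_isPrimitive hH, fun _ g hg n hn hunit hpar hnv => ?_⟩
  have hsmooth := exists_contDiffOn_chartForm_crossStarD (K := K) ho hg hn
  refine ⟨exists_isPrimitive_of_closed _ (fun q => ?_)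
    (extDerivOne_crossStarD_eq_zero ho hg hn hpar), fun y hy => ?_⟩
  · obtain ⟨U, hU, hq, -, h⟩ := hsmooth q
    exact (h.contDiffAt (hU.mem_nhds hq)).differentiableAt (by simp)
  set η : ∀ p : M, TangentSpace (𝓡 2) p →L[ℝ] R3 :=
    fun p => mvfderiv (𝓡 2) n p + crossStarD K g o n p with hηdef
  have hys := hy.contMDiff hsmooth
  have hnd : ∀ p, MDifferentiableAt (𝓡 2) 𝓘(ℝ, R3) n p := fun p =>
    hn.mdifferentiableAt (by simp)
  have hx : ContMDiff (𝓡 2) 𝓘(ℝ, R3) ∞ (fun p => -(1 / (2 * H)) • (n p + y p)) :=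
    ContMDiff.smul (f := fun _ => -(1 / (2 * H))) (contMDiff_const (I' := 𝓘(ℝ, ℝ))) (hn.add hys)
  have hdx : ∀ p, mvfderiv (𝓡 2) (fun p => -(1 / (2 * H)) • (n p + y p)) p =
      (-(1 / (2 * H))) • η p := by
    intro p
    have h1 := mvfderiv_const_smul ((hnd p).add (hy.1 p)) (-(1 / (2 * H)))
    rw [mvfderiv_add (hnd p) (hy.1 p), hy.2 p] at h1
    exact h1
  have hframe := fun p => exists_isOrthonormalFrame K (g p) (hg.symm p) (hg.signature p) (o p)
  have hconf : ∀ p, ∃ c, IsConformalAt K (g p) (o p) (n p) (mvfderiv (𝓡 2) n p) (η p) c := by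
    intro p
    obtain ⟨b, hb⟩ := hframe p
    exact ⟨_, hb.isConformalAt (hunit p) (form_mvfderiv_eq_zero hn hunit p)⟩
  choose c hc using hconf
  have hinj : (∀ p v, v ≠ 0 → η p v ≠ 0) → ∀ p, Function.Injective (η p) := fun h p =>
    (injective_iff_map_eq_zero _).2 fun v hv => by_contra fun hv0 => h p v hv0 hv
  have hriem : K ≠ .timelike → (∀ p v, v ≠ 0 → 0 < g p v v) → (∀ p, η p ≠ 0) →
      IsCMC K o H (fun p => -(1 / (2 * H)) • (n p + y p)) n := by
    intro hK hpos hne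
    have hcpos : ∀ p, 0 < c p := fun p => (hc p).pos hK (hpos p) (hunit p) (hne p)
    -- Here η is only assumed nonzero at each point; conformality with c > 0 and g positive definite
    -- makes it injective.
    refine isCMC_of_conformal_pos hH hg hx hn hdx hc (hinj fun p v hv h0 => ?_) hcpos
    have := (hc p).form_eq v v
    rw [h0, map_zero] at this
    exact (mul_pos (hcpos p) (hpos p v hv)).ne this
  cases K with
  | euclidean => exact Or.inl (hriem (by simp) hg.signature hnv)
  | spacelike => exact Or.inl (hriem (by simp) hg.signature hnv)
  | timelike =>
    have hηc : ∀ p, ContinuousAt (chartForm η p) (extChartAt (𝓡 2) p p) := by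
      intro p
      obtain ⟨U, hU, hp, hUt, h⟩ := hsmooth p
      have h1 := (h.continuousOn.continuousAt (hU.mem_nhds hp))
      have h2 := ((contDiffOn_chartForm_mvfderiv hn p).continuousOn.continuousAt
        ((isOpen_target p).mem_nhds (mem_extChartAt_target (I := 𝓡 2) p)))
      refine (h2.add h1).congr (Filter.Eventually.of_forall fun z => ?_)
      exact (ContinuousLinearMap.add_comp _ _ _).symm
    have hc0 : ∀ p, c p ≠ 0 := by
      intro p
      obtain ⟨b, hb⟩ := hframe p
      exact (hc p).ne_zero hb (hnv p)
    rcases conformal_factor_pos_or_neg hg hηc (fun p => (hc p).form_eq) hc0 with h | h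
    · exact Or.inl (isCMC_of_conformal_pos hH hg hx hn hdx hc (hinj hnv) h)
    · exact Or.inr ⟨rfl, isCMC_neg_of_conformal_neg hH hg hx hn hdx hc (hinj hnv) h⟩

end
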